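/- Let $N\ge 0$ be an integer, and let $f:\mathbb{C}^N\to\mathbb{C}^N$ be complex entire with $f(\mathbb{R}^N)\subseteq\mathbb{R}^N$. Let $v$ be a hyperbolic equilibrium of $f$: $f(v)=0$, and no eigenvalue of the linearization $A=f'(v)$ has real part zero. Let $A^-$ and $A^+$ denote the restrictions of $A$ to the sums of the generalized eigenspaces for the eigenvalues with negative and with positive real part, respectively. Assume that $A^-$ and $A^+$ are diagonalizable, that all their eigenvalues are real, and that they are separately nonresonant: for each sign $\pm$, with $\mu_1^\pm,\dots,\mu_{N^\pm}^\pm$ denoting the eigenvalues of $A^\pm$, $$\mu^\pm_{j_0}\neq\sum_{j} n_j\,\mu^\pm_j$$ for every index $j_0$ and all integers $n_j\ge 0$ with $\sum_j n_j\ge 2$. Let $\Gamma:\mathbb{R}\to\mathbb{R}^N$ be any real homoclinic orbit to $v$, that is, a nonconstant solution of $\dot\Gamma(t)=f(\Gamma(t))$, $t\in\mathbb{R}$, with $\Gamma(t)\to v$ for $t\to+\infty$ and for $t\to-\infty$. Then $\Gamma$ does not extend to a complex entire function: there is no holomorphic $G:\mathbb{C}\to\mathbb{C}^N$ with $G(t)=\Gamma(t)$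 for all $t\in\mathbb{R}$. -/

import Mathlib

open Filter Topology

noncomputable section

/-- The inclusion of real space `ℝ^N` into its complexification `ℂ^N`. -/
def realToComplex {N : ℕ} (x : Fin N → ℝ) : Fin N → ℂ := fun i => (x i : ℂ)

/-- A complex entire vector field on `ℂ^N` that takes real values at real arguments. -/
structure IsRealEntire {N : ℕ} (f : (Fin N → ℂ) → (Fin N → ℂ)) : Prop where
  entire : Differentiable ℂ f
  real_on_real : ∀ x : Fin N → ℝ, ∃ y : Fin N → ℝ, f (realToComplex x) = realToComplex y

/-- The linearization `A = f'(v)`, as a complex linear endomorphism of `ℂ^N`. -/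
def linearization {N : ℕ} (f : (Fin N → ℂ) → (Fin N → ℂ)) (v : Fin N → ℂ) :
    Module.End ℂ (Fin N → ℂ) :=
  (fderiv ℂ f v : (Fin N → ℂ) →ₗ[ℂ] (Fin N → ℂ))

/-- `v` is an equilibrium of `f`, and no eigenvalue of `f'(v)` has vanishing real part. -/
structure IsHyperbolicEquilibrium {N : ℕ} (f : (Fin N → ℂ) → (Fin N → ℂ))
    (v : Fin N → ℂ) : Prop where
  equilibrium : f v = 0
  hyperbolic : ∀ μ : ℂ, (linearization f v).HasEigenvalue μ → μ.re ≠ 0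

section Blocks

variable {V : Type*} [AddCommGroup V] [Module ℂ V]

/-- The sum of the generalized eigenspaces of `A` for the eigenvalues lying in `S`. -/
def spectralSubspace (A : Module.End ℂ V) (S : Set ℂ) : Submodule ℂ V :=
  ⨆ μ ∈ S, A.maxGenEigenspace μ

theorem spectralSubspace_mapsTo (A : Module.End ℂ V) (S : Set ℂ) :
    ∀ x ∈ spectralSubspace A S, A x ∈ spectralSubspace A S := by
  intro x hx
  have h : spectralSubspace A S ≤ (spectralSubspace A S).comap A := by
    refine iSup₂_le fun μ hμ y hy => ?_
    have h1 : A y ∈ A.maxGenEigenspace μ :=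
      Module.End.mapsTo_maxGenEigenspace_of_comm (Commute.refl A) μ hy
    exact (le_iSup₂_of_le μ hμ le_rfl : A.maxGenEigenspace μ ≤ spectralSubspace A S) h1
  exact h hx

/-- The diagonal block of `A` on the generalized eigenspaces for the eigenvalues in `S`. -/
def spectralBlock (A : Module.End ℂ V) (S : Set ℂ) : Module.End ℂ (spectralSubspace A S) :=
  A.restrict (spectralSubspace_mapsTo A S)

/-- The stable block `A⁻`, carrying all eigenvalues of `A` with negative real part. -/
abbrev stableBlock (A : Module.End ℂ V) :
    Module.End ℂ (spectralSubspace A {μ | μ.re < 0}) :=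
  spectralBlock A {μ | μ.re < 0}

/-- The unstable block `A⁺`, carrying all eigenvalues of `A` with positive real part. -/
abbrev unstableBlock (A : Module.End ℂ V) :
    Module.End ℂ (spectralSubspace A {μ | 0 < μ.re}) :=
  spectralBlock A {μ | 0 < μ.re}

/-- `B` has a basis of eigenvectors. -/
def IsDiagonalizable (B : Module.End ℂ V) : Prop :=
  ∃ (b : Module.Basis (Fin (Module.finrank ℂ V)) ℂ V)
    (μ : Fin (Module.finrank ℂ V) → ℂ), ∀ j, B (b j) = μ j • b j

/-- All eigenvalues of `B` are real. -/
def HasRealSpectrum (B : Module.End ℂ V) : Prop :=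
  ∀ μ : ℂ, B.HasEigenvalue μ → μ.im = 0

/-- No eigenvalue of `B` is a combination of eigenvalues of `B` with nonnegative integer
coefficients of total order at least two. Multi-indices are indexed by the distinct eigenvalues:
listing an eigenvalue repeatedly, by multiplicity, gives the same sums and the same orders. -/
def IsNonresonant [FiniteDimensional ℂ V] (B : Module.End ℂ V) : Prop :=
  ∀ (μ₀ : B.Eigenvalues) (n : B.Eigenvalues → ℕ), 2 ≤ ∑ μ, n μ →
    (μ₀ : ℂ) ≠ ∑ μ, (n μ : ℂ) * (μ : ℂ)

end Blocks

/-- `Γ` is a real homoclinic orbit of `ẋ = f(x)` to `v`: a nonstationary real solution, defined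
for all real times, which converges to `v` for `t → ±∞`. -/
structure IsRealHomoclinicOrbit {N : ℕ} (f : (Fin N → ℂ) → (Fin N → ℂ)) (v : Fin N → ℂ)
    (Γ : ℝ → Fin N → ℝ) : Prop where
  solution : ∀ t : ℝ,
    HasDerivAt (fun s : ℝ => realToComplex (Γ s)) (f (realToComplex (Γ t))) t
  nonstationary : ∃ s t : ℝ, Γ s ≠ Γ t
  tendsto_atTop : Tendsto (fun t : ℝ => realToComplex (Γ t)) atTop (𝓝 v)
  tendsto_atBot : Tendsto (fun t : ℝ => realToComplex (Γ t)) atBot (𝓝 v)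

/-- `Γ` is the restriction to real times of a complex entire function of time. -/
def ExtendsToEntire {N : ℕ} (Γ : ℝ → Fin N → ℝ) : Prop :=
  ∃ G : ℂ → Fin N → ℂ, Differentiable ℂ G ∧ ∀ t : ℝ, G (t : ℂ) = realToComplex (Γ t)

end

/-! If an entire extension `G` exists, the identity theorem makes it solve the differential equation
at all complex times. In an eigenbasis of the linearization, centred at the equilibrium, this
becomes an entire orbit `u` of a field with real diagonal linear part `l`. The plan is to show that
`u` is bounded on ℂ, hence constant by Liouville, against nonconstancy of the orbit.

Right half-plane. On the real axis `u` decays exponentially. Nonresonance of the stable eigenvalues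
lets each forced linear equation be solved without secular terms, so up to any order `exp (-K t)`
the orbit equals an exponential sum `p` whose exponents are nonnegative integer combinations of the
stable eigenvalues (`exists_improved_expansion`, `exists_approximate_solution`). Being an
exponential sum, `p` obeys the same decay estimates uniformly in imaginary time. A continuation
argument then carries the estimate on `u - p` from the real axis to a half-plane
(`exists_halfPlane_approximation`): a short vertical move at most doubles the error, and integrating
back from infinity along horizontal rays halves it again. Time reversal exchanges the stable and
unstable blocks and treats a left half-plane.

Strip in between. The phases of `p` return simultaneously to 1 at arbitrarily large imaginary times
`s`. Far to the right, `u` at `b + i s` is therefore very close to `u` at `b`. If `K` exceeds the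
growth rate of errors under backward integration, this closeness survives back across the strip
(`eventually_norm_le_recurrenceFilter`). Hence `u` is bounded on horizontal segments at heights `s`
and `-s`, and the maximum principle on the rectangles they bound controls the whole strip
(`apply_eq_apply`). -/

/-! ### Entire maps of several variables -/

section SeveralVariables

variable {E F : Type*} [NormedAddCommGroup E] [NormedSpace ℂ E]
  [NormedAddCommGroup F] [NormedSpace ℂ F] [CompleteSpace F]

/-- Cauchy's formula on a complex line. The right side involves only values of `f`, so regularity of
`f` in `x` passes to its derivative. -/
theorem fderiv_apply_eq_circleIntegral {f : E → F} (hf : Differentiable ℂ f) (x e : E) :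
    fderiv ℂ f x e =
      (2 * Real.pi * Complex.I : ℂ)⁻¹ • ∮ z in C(0, 1), z ^ (-2 : ℤ) • f (x + z • e) := by
  have hd : Differentiable ℂ (fun z : ℂ => f (x + z • e)) := by fun_prop
  have h1 : HasDerivAt (fun z : ℂ => f (x + z • e)) (fderiv ℂ f x e) 0 := by
    have h2 : HasFDerivAt f (fderiv ℂ f x) (x + (0 : ℂ) • e) := by
      simpa using (hf x).hasFDerivAt
    have h3 : HasDerivAt (fun z : ℂ => x + z • e) e 0 := by
      simpa using ((hasDerivAt_id (0 : ℂ)).smul_const e).const_add x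
    exact h2.comp_hasDerivAt (0 : ℂ) h3
  have h4 := DiffContOnCl.deriv_eq_smul_circleIntegral (c := 0) one_pos hd.diffContOnCl
  rw [h1.deriv] at h4
  have h5 : (2 * Real.pi * Complex.I : ℂ) ≠ 0 := by simp
  rw [eq_inv_smul_iff₀ h5]
  simpa [zpow_neg, zpow_ofNat] using h4.symm

variable [FiniteDimensional ℂ E]

theorem continuous_fderiv_of_differentiable {f : E → F} (hf : Differentiable ℂ f) :
    Continuous (fderiv ℂ f) := by
  refine continuous_clm_apply.2 fun e => ?_
  simp_rw [fderiv_apply_eq_circleIntegral hf]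
  refine Continuous.const_smul ?_ _
  unfold circleIntegral
  refine intervalIntegral.continuous_parametric_intervalIntegral_of_continuous' ?_ _ _
  have hf' := hf.continuous
  have h0 : ∀ y : E × ℝ, circleMap 0 1 y.2 ≠ 0 := fun y => by simp
  simp only [deriv_circleMap, Function.uncurry_def]
  refine Continuous.smul (by fun_prop) (Continuous.smul ?_ ?_)
  · exact Continuous.zpow₀ (by fun_prop) _ fun y => Or.inl (h0 y)
  · fun_prop

/-- The Cauchy integral may be differentiated under the integral sign: the derivative of the
integrand is continuous, hence bounded on the product of a compact ball and the circle. -/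
theorem differentiable_fderiv_apply {f : E → F} (hf : Differentiable ℂ f) (e : E) :
    Differentiable ℂ (fun x => fderiv ℂ f x e) := by
  have : ProperSpace E := FiniteDimensional.proper ℂ E
  have hf' := hf.continuous
  have hc := continuous_fderiv_of_differentiable hf
  have h0 : ∀ y : ℝ, circleMap 0 1 y ≠ 0 := fun y => by simp
  set c : ℝ → ℂ := fun θ => deriv (circleMap 0 1) θ * circleMap 0 1 θ ^ (-2 : ℤ) with hcdef
  have hcc : Continuous c := by
    simp only [hcdef, deriv_circleMap]
    refine Continuous.mul (by fun_prop) ?_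
    exact Continuous.zpow₀ (by fun_prop) _ fun y => Or.inl (h0 y)
  have key : ∀ x, fderiv ℂ f x e = (2 * Real.pi * Complex.I : ℂ)⁻¹ •
      ∫ θ in (0 : ℝ)..2 * Real.pi, c θ • f (x + circleMap 0 1 θ • e) := by
    intro x
    rw [fderiv_apply_eq_circleIntegral hf, circleIntegral]
    simp only [hcdef, smul_smul]
  simp_rw [key]
  refine Differentiable.const_smul ?_ _
  intro x₀
  obtain ⟨C, hC⟩ := ((isCompact_closedBall x₀ 1).prod
    (isCompact_Icc (a := (0 : ℝ)) (b := 2 * Real.pi))).exists_bound_of_continuousOn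
    (f := fun y : E × ℝ => c y.2 • fderiv ℂ f (y.1 + circleMap 0 1 y.2 • e))
    (by fun_prop)
  refine (intervalIntegral.hasFDerivAt_integral_of_dominated_of_fderiv_le (𝕜 := ℂ)
    (F' := fun x θ => c θ • fderiv ℂ f (x + circleMap 0 1 θ • e)) (bound := fun _ => C)
    (Metric.closedBall_mem_nhds x₀ one_pos) ?_ ?_ ?_ ?_ ?_ ?_).differentiableAt
  · refine Eventually.of_forall fun x => Continuous.aestronglyMeasurable (by fun_prop)
  · exact Continuous.intervalIntegrable (by fun_prop) _ _
  · exact Continuous.aestronglyMeasurable (by fun_prop)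
  · refine Eventually.of_forall fun θ hθ x hx => ?_
    rw [Set.uIoc_of_le (by positivity)] at hθ
    exact hC (x, θ) ⟨hx, hθ.1.le, hθ.2⟩
  · exact intervalIntegrable_const
  · refine Eventually.of_forall fun θ hθ x hx => ?_
    refine HasFDerivAt.const_smul ?_ (c θ)
    have h1 := (hf (x + circleMap 0 1 θ • e)).hasFDerivAt
    exact h1.comp x ((hasFDerivAt_id x).add_const _)

theorem contDiff_of_differentiable {f : E → F} (hf : Differentiable ℂ f) (n : ℕ) :
    ContDiff ℂ n f := by
  induction n generalizing f with
  | zero => exact contDiff_zero.2 hf.continuous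
  | succ n ih =>
    push_cast
    refine contDiff_succ_iff_fderiv_apply.2 ⟨hf, fun h => ?_, fun y =>
      ih (differentiable_fderiv_apply hf y)⟩
    exact absurd h (by simp)

theorem differentiable_fderiv_of_differentiable {f : E → F} (hf : Differentiable ℂ f) :
    Differentiable ℂ (fderiv ℂ f) :=
  ((contDiff_of_differentiable hf 2).fderiv_right (m := 1) (by norm_num)).differentiable (by norm_num)

/-- An entire map without linear part at the origin is small and quadratic near the origin. -/
theorem exists_norm_sub_le_mul_of_fderiv_zero {g : E → F} (hg : Differentiable ℂ g)
    (h0 : fderiv ℂ g 0 = 0) : ∃ C > 0, ∃ δ > 0, ∀ r ≤ δ, ∀ x y, ‖x‖ ≤ r → ‖y‖ ≤ r →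
      ‖g x - g y‖ ≤ C * r * ‖x - y‖ := by
  have h1 := (differentiable_fderiv_of_differentiable hg 0).isBigO_sub
  obtain ⟨C, hC, h2⟩ := h1.exists_pos
  obtain ⟨δ, hδ, h3⟩ := Metric.eventually_nhds_iff_ball.1 h2.bound
  -- Half of `δ`, because the bound on the derivative holds on an open ball.
  refine ⟨C, hC, δ / 2, by positivity, fun r hr x y hx hy => ?_⟩
  refine (convex_closedBall (0 : E) r).norm_image_sub_le_of_norm_fderiv_le (𝕜 := ℂ)
    (fun z _ => hg z) (fun z hz => ?_) (by simpa using hy) (by simpa using hx)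
  have hz' : ‖z‖ ≤ r := by simpa using hz
  have h4 := h3 z (by simp; linarith)
  rw [h0] at h4
  simp only [sub_zero] at h4
  exact h4.trans (by gcongr)

/-- An entire map is Lipschitz on bounded sets. -/
theorem exists_norm_sub_le_of_differentiable {g : E → F} (hg : Differentiable ℂ g) (r : ℝ) :
    ∃ L > 0, ∀ x y, ‖x‖ ≤ r → ‖y‖ ≤ r → ‖g x - g y‖ ≤ L * ‖x - y‖ := by
  have : ProperSpace E := FiniteDimensional.proper ℂ E
  obtain ⟨C, hC⟩ := (isCompact_closedBall (0 : E) r).exists_bound_of_continuousOn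
    (continuous_fderiv_of_differentiable hg).continuousOn
  refine ⟨max C 1, by positivity, fun x y hx hy => ?_⟩
  exact (convex_closedBall (0 : E) r).norm_image_sub_le_of_norm_fderiv_le (𝕜 := ℂ)
    (fun z _ => hg z) (fun z hz => (hC z hz).trans (le_max_left _ _))
    (by simpa using hy) (by simpa using hx)

end SeveralVariables

/-! ### Exponential sums on right half-planes -/

/-- The filter of complex numbers whose real part tends to `+∞`. -/
def atRight : Filter ℂ := comap Complex.re atTop

theorem eventually_atRight {p : ℂ → Prop} :
    (∀ᶠ z in atRight, p z) ↔ ∃ T : ℝ, ∀ z : ℂ, T ≤ z.re → p z := by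
  have h := (atTop_basis.comap Complex.re).eventually_iff (q := p)
  simp only [true_and, Set.mem_preimage, Set.mem_Ici] at h
  exact h

theorem tendsto_re_atRight : Tendsto Complex.re atRight atTop := tendsto_comap

theorem tendsto_ofReal_atRight : Tendsto (fun t : ℝ => (t : ℂ)) atTop atRight :=
  tendsto_comap_iff.2 (by simpa [Function.comp_def] using! tendsto_id)

theorem tendsto_exp_neg_mul_atTop {κ : ℝ} (hκ : 0 < κ) :
    Tendsto (fun t : ℝ => Real.exp (-κ * t)) atTop (𝓝 0) :=
  Real.tendsto_exp_atBot.comp (tendsto_id.const_mul_atTop_of_neg (neg_lt_zero.2 hκ))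

theorem isBigO_exp_of_le {κ κ' : ℝ} (h : κ' ≤ κ) :
    (fun t : ℝ => Real.exp (-κ * t)) =O[atTop] fun t : ℝ => Real.exp (-κ' * t) := by
  refine Asymptotics.IsBigO.of_bound 1 ?_
  filter_upwards [eventually_ge_atTop 0] with t ht
  simp only [Real.norm_eq_abs, Real.abs_exp, one_mul]
  exact Real.exp_le_exp.2 (by nlinarith)

theorem isBigO_exp_re_of_le {κ κ' : ℝ} (h : κ' ≤ κ) :
    (fun z : ℂ => Real.exp (-κ * z.re)) =O[atRight] fun z : ℂ => Real.exp (-κ' * z.re) :=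
  (isBigO_exp_of_le h).comp_tendsto tendsto_re_atRight

/-- The span of the exponentials `z ↦ exp (ν z)` with `ν ∈ S`. -/
def expSpan (S : Set ℝ) : Submodule ℂ (ℂ → ℂ) :=
  Submodule.span ℂ ((fun (ν : ℝ) (z : ℂ) => Complex.exp (ν * z)) '' S)

theorem exp_mem_expSpan {S : Set ℝ} {ν : ℝ} (h : ν ∈ S) :
    (fun z : ℂ => Complex.exp (ν * z)) ∈ expSpan S :=
  Submodule.subset_span ⟨ν, h, rfl⟩

theorem expSpan_mono {S S' : Set ℝ} (h : S ⊆ S') : expSpan S ≤ expSpan S' :=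
  Submodule.span_mono (Set.image_mono h)

theorem expSpan_induction {S : Set ℝ} {p : (ℂ → ℂ) → Prop}
    (hexp : ∀ ν ∈ S, p fun z : ℂ => Complex.exp (ν * z)) (hzero : p 0)
    (hadd : ∀ φ ψ, p φ → p ψ → p (φ + ψ)) (hsmul : ∀ (a : ℂ) φ, p φ → p (a • φ))
    {φ : ℂ → ℂ} (hφ : φ ∈ expSpan S) : p φ := by
  induction hφ using Submodule.span_induction with
  | mem x hx => obtain ⟨ν, hν, rfl⟩ := hx; exact hexp ν hν
  | zero => exact hzero
  | add x y _ _ hx hy => exact hadd x y hx hy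
  | smul a x _ hx => exact hsmul a x hx

theorem mul_mem_expSpan {S S' U : Set ℝ} (h : ∀ a ∈ S, ∀ b ∈ S', a + b ∈ U) {φ ψ : ℂ → ℂ}
    (hφ : φ ∈ expSpan S) (hψ : ψ ∈ expSpan S') : φ * ψ ∈ expSpan U := by
  refine expSpan_induction (p := fun φ => φ * ψ ∈ expSpan U) (fun a ha => ?_) ?_ ?_ ?_ hφ
  · refine expSpan_induction (p := fun ψ => _ * ψ ∈ expSpan U) (fun b hb => ?_) ?_ ?_ ?_ hψ
    · convert exp_mem_expSpan (h a ha b hb) using 1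
      ext z
      simp [add_mul, Complex.exp_add]
    · simp
    · intro x y hx hy; rw [mul_add]; exact add_mem hx hy
    · intro c x hx; rw [mul_smul_comm]; exact Submodule.smul_mem _ _ hx
  · simp
  · intro x y hx hy; rw [add_mul]; exact add_mem hx hy
  · intro c x hx; rw [smul_mul_assoc]; exact Submodule.smul_mem _ _ hx

theorem exists_hasDerivAt_of_mem_expSpan {S : Set ℝ} {φ : ℂ → ℂ} (hφ : φ ∈ expSpan S) :
    ∃ φ' ∈ expSpan S, ∀ z, HasDerivAt φ (φ' z) z := by
  refine expSpan_induction (p := fun φ => ∃ φ' ∈ expSpan S, ∀ z, HasDerivAt φ (φ' z) z)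
    ?_ ?_ ?_ ?_ hφ
  · intro ν hν
    refine ⟨(ν : ℂ) • fun z : ℂ => Complex.exp (ν * z),
      Submodule.smul_mem _ _ (exp_mem_expSpan hν), fun z => ?_⟩
    refine ((hasDerivAt_id z).const_mul (ν : ℂ)).cexp.congr_deriv ?_
    simp [mul_comm]
  · exact ⟨0, zero_mem _, fun z => hasDerivAt_const z 0⟩
  · rintro φ ψ ⟨φ', h1, h2⟩ ⟨ψ', h3, h4⟩
    exact ⟨φ' + ψ', add_mem h1 h3, fun z => (h2 z).add (h4 z)⟩
  · rintro a φ ⟨φ', h1, h2⟩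
    exact ⟨a • φ', Submodule.smul_mem _ _ h1, fun z => (h2 z).const_smul a⟩

/-- A linear scalar equation forced by nonresonant exponentials has a solution of the same form. -/
theorem exists_solution_mem_expSpan {S : Set ℝ} {μ : ℝ} (hμ : μ ∉ S) {q : ℂ → ℂ}
    (hq : q ∈ expSpan S) : ∃ w ∈ expSpan S, ∀ z, HasDerivAt w (μ * w z + q z) z := by
  refine expSpan_induction (p := fun q => ∃ w ∈ expSpan S, ∀ z, HasDerivAt w (μ * w z + q z) z)
    ?_ ?_ ?_ ?_ hq
  · intro ν hν
    have h0 : ((ν : ℂ) - μ) ≠ 0 := by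
      rw [← Complex.ofReal_sub, Complex.ofReal_ne_zero, sub_ne_zero]
      rintro rfl
      exact hμ hν
    -- For `ν = μ` a secular term `z * exp (μ z)` would be forced, which is neither in the span nor
    -- recurrent in the imaginary direction.
    refine ⟨((ν : ℂ) - μ)⁻¹ • fun z : ℂ => Complex.exp (ν * z),
      Submodule.smul_mem _ _ (exp_mem_expSpan hν), fun z => ?_⟩
    refine (((hasDerivAt_id z).const_mul (ν : ℂ)).cexp.const_smul ((ν : ℂ) - μ)⁻¹).congr_deriv ?_
    simp only [Pi.smul_apply, smul_eq_mul, id, mul_one]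
    field_simp
    ring
  · exact ⟨0, zero_mem _, fun z => (hasDerivAt_const z (0 : ℂ)).congr_deriv (by simp)⟩
  · rintro φ ψ ⟨φ', h1, h2⟩ ⟨ψ', h3, h4⟩
    refine ⟨φ' + ψ', add_mem h1 h3, fun z => ?_⟩
    refine ((h2 z).add (h4 z)).congr_deriv ?_
    simp only [Pi.add_apply]; ring
  · rintro a φ ⟨φ', h1, h2⟩
    refine ⟨a • φ', Submodule.smul_mem _ _ h1, fun z => ?_⟩
    refine ((h2 z).const_smul a).congr_deriv ?_
    simp only [Pi.smul_apply, smul_eq_mul]; ring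

theorem norm_exp_ofReal_mul (ν : ℝ) (z : ℂ) : ‖Complex.exp (ν * z)‖ = Real.exp (ν * z.re) := by
  rw [Complex.norm_exp]; simp

theorem isBigO_of_mem_expSpan {S : Set ℝ} {κ : ℝ} (h : ∀ ν ∈ S, ν ≤ -κ) {φ : ℂ → ℂ}
    (hφ : φ ∈ expSpan S) : φ =O[atRight] fun z : ℂ => Real.exp (-κ * z.re) := by
  refine expSpan_induction (p := fun φ => φ =O[atRight] fun z : ℂ => Real.exp (-κ * z.re))
    ?_ ?_ ?_ ?_ hφ
  · intro ν hν
    have h1 := isBigO_exp_re_of_le (κ := -ν) (κ' := κ) (by linarith [h ν hν])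
    refine (Asymptotics.IsBigO.of_norm_le fun z => ?_).trans h1
    rw [norm_exp_ofReal_mul]; simp
  · exact Asymptotics.isBigO_zero _ _
  · intro φ ψ h1 h2; exact h1.add h2
  · intro a φ h1; exact h1.const_smul_left a

/-- Induction on the largest exponent `a`: after multiplication by `exp (-a t)` the sum tends to `c
a`, while the decay hypothesis sends it to 0. -/
theorem coeff_eq_zero_of_isBigO {κ : ℝ} (s : Finset ℝ) (c : ℝ → ℂ) (hs : ∀ ν ∈ s, -κ < ν)
    (h : (fun t : ℝ => ∑ ν ∈ s, c ν * Complex.exp (ν * t)) =O[atTop]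
      fun t : ℝ => Real.exp (-κ * t)) : ∀ ν ∈ s, c ν = 0 := by
  induction s using Finset.induction_on_max with
  | empty => simp
  | insert a s ha ih =>
    have has : a ∉ s := fun h' => lt_irrefl _ (ha a h')
    have key : c a = 0 := by
      have h1 : Tendsto (fun t : ℝ => (∑ ν ∈ insert a s, c ν * Complex.exp (ν * t)) *
          Complex.exp (-a * t)) atTop (𝓝 0) := by
        have h2 : (fun t : ℝ => Complex.exp (-a * t)) =O[atTop]
            fun t : ℝ => Real.exp (-a * t) :=
          Asymptotics.IsBigO.of_norm_le fun t => by
            have := norm_exp_ofReal_mul (-a) t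
            push_cast at this
            rw [this]; simp
        refine (h.mul h2).trans_tendsto ?_
        simp_rw [← Real.exp_add]
        convert tendsto_exp_neg_mul_atTop (κ := κ + a) (by linarith [hs a (by simp)]) using 2
        ring_nf
      have h3 : Tendsto (fun t : ℝ => (∑ ν ∈ insert a s, c ν * Complex.exp (ν * t)) *
          Complex.exp (-a * t)) atTop (𝓝 (c a)) := by
        have h4 : ∀ t : ℝ, (∑ ν ∈ insert a s, c ν * Complex.exp (ν * t)) *
            Complex.exp (-a * t) = c a + ∑ ν ∈ s, c ν * Complex.exp ((ν - a : ℝ) * t) := by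
          intro t
          rw [Finset.sum_mul, Finset.sum_insert has]
          congr 1
          · rw [mul_assoc, ← Complex.exp_add]; simp
          · refine Finset.sum_congr rfl fun ν _ => ?_
            rw [mul_assoc, ← Complex.exp_add]; push_cast; ring_nf
        simp_rw [h4]
        have h5 : Tendsto (fun t : ℝ => ∑ ν ∈ s, c ν * Complex.exp ((ν - a : ℝ) * t)) atTop
            (𝓝 (∑ ν ∈ s, c ν * 0)) := by
          refine tendsto_finsetSum _ fun ν hν => Tendsto.const_mul _ ?_
          rw [tendsto_zero_iff_norm_tendsto_zero]
          simp_rw [norm_exp_ofReal_mul, Complex.ofReal_re]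
          simpa using tendsto_exp_neg_mul_atTop (κ := a - ν) (by linarith [ha ν hν])
        simpa using h5.const_add (c a)
      exact tendsto_nhds_unique h3 h1
    intro ν hν
    rcases Finset.mem_insert.1 hν with rfl | hν
    · exact key
    · refine ih (fun ν hν => hs ν (by simp [hν])) ?_ ν hν
      simpa [Finset.sum_insert has, key] using h

/-- An exponential sum that decays at a given rate along the real axis decays at that rate
uniformly on right half-planes. -/
theorem isBigO_atRight_of_isBigO_real {S : Set ℝ} {κ : ℝ} {φ : ℂ → ℂ} (hφ : φ ∈ expSpan S)
    (h : (fun t : ℝ => φ t) =O[atTop] fun t : ℝ => Real.exp (-κ * t)) :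
    φ =O[atRight] fun z : ℂ => Real.exp (-κ * z.re) := by
  -- Split the exponents at `-κ`. The fast part decays uniformly; the slow part inherits the decay
  -- on the real axis, so its coefficients vanish.
  have h1 : φ ∈ expSpan {ν | ν ≤ -κ} ⊔ expSpan {ν | -κ < ν} := by
    rw [expSpan, expSpan, ← Submodule.span_union, ← Set.image_union]
    refine expSpan_mono (fun ν _ => ?_) hφ
    exact le_or_gt ν (-κ)
  obtain ⟨φ₁, h2, φ₂, h3, rfl⟩ := Submodule.mem_sup.1 h1
  have h4 := isBigO_of_mem_expSpan (fun ν hν => hν) h2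
  have h5 : φ₂ = 0 := by
    obtain ⟨l, hl, rfl⟩ := (Finsupp.mem_span_image_iff_linearCombination ℂ).1 h3
    have h6 : (fun t : ℝ => ∑ ν ∈ l.support, l ν * Complex.exp (ν * t)) =O[atTop]
        fun t : ℝ => Real.exp (-κ * t) := by
      have h7 := h.sub (h4.comp_tendsto tendsto_ofReal_atRight)
      simpa [Function.comp_def, Finsupp.linearCombination_apply, Finsupp.sum] using h7
    have h8 := coeff_eq_zero_of_isBigO l.support l
      (fun ν hν => (Finsupp.mem_supported ℂ l).1 hl hν) h6
    have h9 : l = 0 := by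
      ext ν
      by_contra h10
      exact h10 (h8 ν (by simpa using h10))
    simp [h9]
  simpa [h5] using h4

/-! ### Stable exponents and recurrence of their phases -/

section Exponents

variable {N : ℕ}

/-- The sums `∑ n j * l j` of order at least `m`, over the negative entries of `l`. -/
def stableExponents (l : Fin N → ℝ) (m : ℕ) : Set ℝ :=
  {ν | ∃ n : Fin N → ℕ, (∀ j, 0 < l j → n j = 0) ∧ m ≤ ∑ j, n j ∧ ν = ∑ j, n j * l j}

theorem stableExponents_anti (l : Fin N → ℝ) {m m' : ℕ} (h : m ≤ m') :
    stableExponents l m' ⊆ stableExponents l m :=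
  fun _ ⟨n, h1, h2, h3⟩ => ⟨n, h1, h.trans h2, h3⟩

theorem add_mem_stableExponents {l : Fin N → ℝ} {m m' : ℕ} {a b : ℝ}
    (ha : a ∈ stableExponents l m) (hb : b ∈ stableExponents l m') :
    a + b ∈ stableExponents l (m + m') := by
  obtain ⟨n, h1, h2, rfl⟩ := ha
  obtain ⟨n', h1', h2', rfl⟩ := hb
  refine ⟨n + n', fun j hj => by simp [h1 j hj, h1' j hj], ?_, ?_⟩
  · simp only [Pi.add_apply, Finset.sum_add_distrib]; omega
  · simp [add_mul, Finset.sum_add_distrib]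

theorem mem_stableExponents_one {l : Fin N → ℝ} {j : Fin N} (hj : l j < 0) :
    l j ∈ stableExponents l 1 := by
  refine ⟨Pi.single j 1, fun k hk => ?_, ?_, ?_⟩
  · rw [Pi.single_apply, if_neg]
    rintro rfl
    linarith
  · simp
  · rw [Finset.sum_eq_single j] <;> simp +contextual

theorem le_of_mem_stableExponents {l : Fin N → ℝ} {a : ℝ} (ha : 0 < a) (hl : ∀ j, a ≤ |l j|)
    {ν : ℝ} (hν : ν ∈ stableExponents l 1) : ν ≤ -a := by
  obtain ⟨n, h1, h2, rfl⟩ := hν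
  have h3 : ∑ j, (n j : ℝ) * l j ≤ ∑ j, (n j : ℝ) * -a := by
    refine Finset.sum_le_sum fun j _ => ?_
    rcases lt_or_ge 0 (l j) with h | h
    · simp [h1 j h]
    · have := hl j
      rw [abs_of_nonpos h] at this
      gcongr
      linarith
  rw [← Finset.sum_mul] at h3
  have h4 : (1 : ℝ) ≤ ∑ j, (n j : ℝ) := by exact_mod_cast h2
  nlinarith

/-- Times tending to `+∞` along which all phases `exp (i l j s)` return to `1`. -/
noncomputable def recurrenceFilter (l : Fin N → ℝ) : Filter ℝ :=
  atTop ⊓ comap (fun (s : ℝ) (j : Fin N) => Complex.exp (l j * s * Complex.I)) (𝓝 1)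

/-- Compactness of the torus: the phases at integer times have a convergent subsequence, and the
quotient of two of its late terms is the phase vector at the difference of their times. Fixing one
term and letting the other run makes this difference arbitrarily large. -/
instance recurrenceFilter_neBot (l : Fin N → ℝ) : (recurrenceFilter l).NeBot := by
  set x : ℕ → Fin N → ℂ := fun m j => Complex.exp (l j * (m : ℝ) * Complex.I) with hx
  have hnorm : ∀ m j, ‖x m j‖ = 1 := fun m j => by
    simp only [hx, ← Complex.ofReal_mul, Complex.norm_exp_ofReal_mul_I]
  have hx0 : ∀ m j, x m j ≠ 0 := fun m j => Complex.exp_ne_zero _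
  obtain ⟨y, -, φ, hφ, hy⟩ := tendsto_subseq_of_bounded (x := x)
    (Metric.isBounded_closedBall (x := (0 : Fin N → ℂ)) (r := 1)) (fun m => by
      rw [mem_closedBall_zero_iff, pi_norm_le_iff_of_nonneg zero_le_one]
      exact fun j => (hnorm m j).le)
  have hy0 : ∀ j, y j ≠ 0 := fun j => by
    have h1 := ((continuous_apply j).tendsto y).comp hy
    have h2 : ‖y j‖ = 1 := tendsto_nhds_unique h1.norm (by simp [hnorm])
    intro h3
    simp [h3] at h2
  rw [recurrenceFilter, inf_neBot_iff_frequently_right]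
  intro p hp
  obtain ⟨U, hU, hUp⟩ := mem_comap.1 hp
  rw [frequently_atTop]
  intro s₀
  have h3 : Tendsto (fun ab : ℕ × ℕ => fun j => x (φ ab.1) j / x (φ ab.2) j)
      (atTop ×ˢ atTop) (𝓝 1) := by
    refine tendsto_pi_nhds.2 fun j => ?_
    have h1 := ((continuous_apply j).tendsto y).comp hy
    have h4 := (h1.comp (tendsto_fst (f := atTop) (g := (atTop : Filter ℕ)))).div
      (h1.comp (tendsto_snd (f := (atTop : Filter ℕ)) (g := atTop))) (hy0 j)
    rw [div_self (hy0 j)] at h4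
    exact h4
  rw [prod_atTop_atTop_eq] at h3
  obtain ⟨⟨a, b⟩, hab⟩ := eventually_atTop.1 (h3.eventually_mem hU)
  obtain ⟨m, hm⟩ := exists_nat_ge s₀
  set k := max a (φ b + m) with hk
  have hk1 : φ b + m ≤ φ k := (le_max_right _ _).trans hφ.le_apply
  have h5 := hab (k, b) ⟨le_max_left _ _, le_rfl⟩
  refine ⟨((φ k : ℝ) - φ b), ?_, hUp ?_⟩
  · have : ((φ b + m : ℕ) : ℝ) ≤ φ k := by exact_mod_cast hk1
    push_cast at this
    linarith
  · change (fun j : Fin N => _) ∈ U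
    convert h5 using 2 with j
    simp only [hx, ← Complex.exp_sub]
    push_cast
    ring_nf

theorem tendsto_recurrenceFilter_atTop (l : Fin N → ℝ) :
    Tendsto (fun s : ℝ => s) (recurrenceFilter l) atTop := inf_le_left

theorem tendsto_exp_recurrenceFilter (l : Fin N → ℝ) {m : ℕ} {ν : ℝ}
    (hν : ν ∈ stableExponents l m) :
    Tendsto (fun s : ℝ => Complex.exp (ν * s * Complex.I)) (recurrenceFilter l) (𝓝 1) := by
  obtain ⟨n, -, -, rfl⟩ := hν
  have h1 : Tendsto (fun (s : ℝ) (j : Fin N) => Complex.exp (l j * s * Complex.I))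
      (recurrenceFilter l) (𝓝 1) := tendsto_iff_comap.2 inf_le_right
  have h2 : Tendsto (fun s : ℝ => ∏ j, Complex.exp (l j * s * Complex.I) ^ n j)
      (recurrenceFilter l) (𝓝 (∏ j, (1 : ℂ) ^ n j)) :=
    tendsto_finsetProd _ fun j _ => (tendsto_pi_nhds.1 h1 j).pow _
  simp only [one_pow, Finset.prod_const_one] at h2
  refine h2.congr fun s => ?_
  simp_rw [← Complex.exp_nat_mul, ← Complex.exp_sum]
  push_cast
  simp only [Finset.sum_mul, mul_assoc]

/-- Exponential sums are recurrent in the imaginary direction. -/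
theorem tendsto_expSpan_recurrenceFilter (l : Fin N → ℝ) {m : ℕ} {φ : ℂ → ℂ}
    (hφ : φ ∈ expSpan (stableExponents l m)) (z : ℂ) :
    Tendsto (fun s : ℝ => φ (z + s * Complex.I)) (recurrenceFilter l) (𝓝 (φ z)) ∧
      Tendsto (fun s : ℝ => φ (z - s * Complex.I)) (recurrenceFilter l) (𝓝 (φ z)) := by
  refine expSpan_induction (p := fun φ =>
    Tendsto (fun s : ℝ => φ (z + s * Complex.I)) (recurrenceFilter l) (𝓝 (φ z)) ∧
      Tendsto (fun s : ℝ => φ (z - s * Complex.I)) (recurrenceFilter l) (𝓝 (φ z)))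
    ?_ ?_ ?_ ?_ hφ
  · intro ν hν
    have h1 := tendsto_exp_recurrenceFilter l hν
    constructor
    · have h2 := h1.const_mul (Complex.exp (ν * z))
      simp_rw [← Complex.exp_add, mul_one] at h2
      convert h2 using 3
      ring
    · have h2 := (h1.inv₀ one_ne_zero).const_mul (Complex.exp (ν * z))
      simp_rw [← Complex.exp_neg, ← Complex.exp_add, inv_one, mul_one] at h2
      convert h2 using 3
      ring
  · exact ⟨tendsto_const_nhds, tendsto_const_nhds⟩
  · exact fun φ ψ h1 h2 => ⟨h1.1.add h2.1, h1.2.add h2.2⟩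
  · exact fun a φ h1 => ⟨h1.1.const_smul a, h1.2.const_smul a⟩

end Exponents

/-! ### Scalar linear equations with decaying forcing -/

section ScalarODE

variable {y h : ℝ → ℂ} {μ κ H T : ℝ}

/-- With the integrating factor `exp (-μ t)` only the forcing is left in the derivative, and its
bound is integrated. The sign of `κ + μ` is left open because both cases occur later. -/
theorem norm_exp_mul_sub_le (hne : κ + μ ≠ 0)
    (hy : ∀ t, T ≤ t → HasDerivAt y (μ * y t + h t) t)
    (hh : ∀ t, T ≤ t → ‖h t‖ ≤ H * Real.exp (-κ * t)) {s t : ℝ} (hs : T ≤ s) (hst : s ≤ t) :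
    ‖Complex.exp (-μ * t) * y t - Complex.exp (-μ * s) * y s‖ ≤
      H / (κ + μ) * (Real.exp (-(κ + μ) * s) - Real.exp (-(κ + μ) * t)) := by
  have hz : ∀ x, T ≤ x → HasDerivAt
      (fun x : ℝ => Complex.exp (-μ * x) * y x - Complex.exp (-μ * s) * y s)
      (Complex.exp (-μ * x) * h x) x := by
    intro x hx
    have h1 : HasDerivAt (fun x : ℝ => Complex.exp (-μ * x)) (Complex.exp (-μ * x) * -μ) x := by
      have h2 : HasDerivAt (fun x : ℝ => (-μ * x : ℂ)) (-μ) x := by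
        simpa using ((Complex.ofRealCLM.hasDerivAt (x := x)).const_mul (-μ : ℂ))
      exact h2.cexp
    refine ((h1.mul (hy x hx)).sub_const _).congr_deriv ?_
    ring
  refine image_norm_le_of_norm_deriv_right_le_deriv_boundary (a := s) (b := t)
    (f := fun x : ℝ => Complex.exp (-μ * x) * y x - Complex.exp (-μ * s) * y s)
    (B := fun x => H / (κ + μ) * (Real.exp (-(κ + μ) * s) - Real.exp (-(κ + μ) * x)))
    (B' := fun x => H * Real.exp (-(κ + μ) * x))
    (fun x hx => (hz x (hs.trans hx.1)).continuousAt.continuousWithinAt)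
    (fun x hx => (hz x (hs.trans hx.1)).hasDerivWithinAt) (by simp) (fun x => ?_)
    (fun x hx => ?_) ⟨hst, le_rfl⟩
  · have h1 : HasDerivAt (fun x : ℝ => -(κ + μ) * x) (-(κ + μ)) x := by
      simpa using (hasDerivAt_id x).const_mul (-(κ + μ))
    refine ((h1.exp.const_sub (Real.exp (-(κ + μ) * s))).const_mul (H / (κ + μ))).congr_deriv ?_
    field_simp
  · have h2 := norm_exp_ofReal_mul (-μ) (x : ℂ)
    push_cast at h2
    rw [norm_mul, h2, Complex.ofReal_re]
    calc Real.exp (-μ * x) * ‖h x‖ ≤ Real.exp (-μ * x) * (H * Real.exp (-κ * x)) := by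
          gcongr; exact hh x (hs.trans hx.1)
      _ = H * Real.exp (-(κ + μ) * x) := by
          rw [mul_left_comm, ← Real.exp_add]; ring_nf

/-- The decaying solution of `y' = μ y + h` is controlled by `h` alone. -/
theorem norm_le_of_tendsto_zero (hpos : 0 < κ + μ)
    (hy : ∀ t, T ≤ t → HasDerivAt y (μ * y t + h t) t)
    (hh : ∀ t, T ≤ t → ‖h t‖ ≤ H * Real.exp (-κ * t))
    (h0 : Tendsto (fun t : ℝ => Complex.exp (-μ * t) * y t) atTop (𝓝 0)) {s : ℝ} (hs : T ≤ s) :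
    ‖y s‖ ≤ H / (κ + μ) * Real.exp (-κ * s) := by
  have h1 : ‖0 - Complex.exp (-μ * s) * y s‖ ≤
      H / (κ + μ) * (Real.exp (-(κ + μ) * s) - 0) := by
    refine le_of_tendsto_of_tendsto (h0.sub_const _).norm
      (((tendsto_exp_neg_mul_atTop hpos).const_sub _).const_mul _) ?_
    filter_upwards [eventually_ge_atTop s] with t ht
    exact norm_exp_mul_sub_le hpos.ne' hy hh hs ht
  have h2 := norm_exp_ofReal_mul (-μ) (s : ℂ)
  push_cast at h2
  rw [zero_sub, norm_neg, norm_mul, h2, Complex.ofReal_re, sub_zero] at h1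
  have h3 : Real.exp (μ * s) * (Real.exp (-μ * s) * ‖y s‖) = ‖y s‖ := by
    rw [← mul_assoc, ← Real.exp_add]; simp
  rw [← h3]
  calc _ ≤ Real.exp (μ * s) * (H / (κ + μ) * Real.exp (-(κ + μ) * s)) := by gcongr
    _ = _ := by rw [mul_left_comm, ← Real.exp_add]; ring_nf

theorem exists_tendsto_exp_mul (hpos : 0 < κ + μ)
    (hy : ∀ t, T ≤ t → HasDerivAt y (μ * y t + h t) t)
    (hh : ∀ t, T ≤ t → ‖h t‖ ≤ H * Real.exp (-κ * t)) :
    ∃ b, Tendsto (fun t : ℝ => Complex.exp (-μ * t) * y t) atTop (𝓝 b) := by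
  have hH : 0 ≤ H := by
    have := (norm_nonneg _).trans (hh T le_rfl)
    exact nonneg_of_mul_nonneg_left this (Real.exp_pos _)
  refine cauchy_map_iff_exists_tendsto.1 ?_
  change CauchySeq _
  rw [Metric.cauchySeq_iff']
  intro ε hε
  have h1 : Tendsto (fun s : ℝ => H / (κ + μ) * Real.exp (-(κ + μ) * s)) atTop (𝓝 0) := by
    simpa using (tendsto_exp_neg_mul_atTop hpos).const_mul (H / (κ + μ))
  obtain ⟨s, hs, hsT⟩ := ((h1.eventually_lt_const hε).and (eventually_ge_atTop T)).exists
  refine ⟨s, fun t ht => ?_⟩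
  rw [dist_eq_norm]
  refine (norm_exp_mul_sub_le hpos.ne' hy hh hsT ht).trans_lt (lt_of_le_of_lt ?_ hs)
  have : 0 ≤ H / (κ + μ) * Real.exp (-(κ + μ) * t) := by positivity
  linarith

/-- A decaying solution of `y' = μ y + h` is, up to the decay rate of `h`, a multiple of
`exp (μ t)`. -/
theorem exists_isBigO_sub_const_mul_exp (hne : κ + μ ≠ 0)
    (hy : ∀ t, HasDerivAt y (μ * y t + h t) t)
    (hh : h =O[atTop] fun t : ℝ => Real.exp (-κ * t)) (hy0 : Tendsto y atTop (𝓝 0)) :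
    ∃ b : ℂ, (0 ≤ μ → b = 0) ∧
      (fun t : ℝ => y t - b * Complex.exp (μ * t)) =O[atTop] fun t : ℝ => Real.exp (-κ * t) := by
  obtain ⟨H, hH, hb⟩ := hh.exists_pos
  obtain ⟨T, hT⟩ := eventually_atTop.1 hb.bound
  simp only [Real.norm_eq_abs, Real.abs_exp] at hT
  rcases lt_or_gt_of_ne hne with hneg | hpos
  -- Here `μ < -κ`, so the homogeneous solution is itself within the error and needs no coefficient.
  · refine ⟨0, fun _ => rfl, ?_⟩
    refine Asymptotics.IsBigO.of_bound
      (‖Complex.exp (-μ * T) * y T‖ * Real.exp ((κ + μ) * T) + H / -(κ + μ)) ?_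
    filter_upwards [eventually_ge_atTop T] with t ht
    have h1 := norm_exp_mul_sub_le hne (fun t _ => hy t) hT le_rfl ht
    have h2 := norm_exp_ofReal_mul (-μ) (t : ℂ)
    push_cast at h2
    have h3 := norm_le_norm_add_norm_sub' (Complex.exp (-μ * t) * y t)
      (Complex.exp (-μ * T) * y T)
    rw [norm_mul, h2, Complex.ofReal_re] at h3
    have h4 : Real.exp (μ * t) * (Real.exp (-μ * t) * ‖y t‖) = ‖y t‖ := by
      rw [← mul_assoc, ← Real.exp_add]; simp
    have h5 : H / (κ + μ) * (Real.exp (-(κ + μ) * T) - Real.exp (-(κ + μ) * t)) ≤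
        H / -(κ + μ) * Real.exp (-(κ + μ) * t) := by
      have : 0 < H / -(κ + μ) * Real.exp (-(κ + μ) * T) := by
        have : 0 < -(κ + μ) := by linarith
        positivity
      rw [div_neg] at this ⊢
      linarith
    have h6 : (1 : ℝ) ≤ Real.exp ((κ + μ) * T) * Real.exp (-(κ + μ) * t) := by
      rw [← Real.exp_add]
      exact Real.one_le_exp (by nlinarith)
    simp only [zero_mul, sub_zero, Real.norm_eq_abs, Real.abs_exp]
    rw [← h4]
    calc Real.exp (μ * t) * (Real.exp (-μ * t) * ‖y t‖)
        ≤ Real.exp (μ * t) * (‖Complex.exp (-μ * T) * y T‖ *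
          (Real.exp ((κ + μ) * T) * Real.exp (-(κ + μ) * t)) +
          H / -(κ + μ) * Real.exp (-(κ + μ) * t)) := by
          gcongr
          refine h3.trans (add_le_add (le_mul_of_one_le_right (norm_nonneg _) h6)
            (h1.trans h5))
      _ = (‖Complex.exp (-μ * T) * y T‖ * Real.exp ((κ + μ) * T) + H / -(κ + μ)) *
          (Real.exp (μ * t) * Real.exp (-(κ + μ) * t)) := by ring
      _ = _ := by rw [← Real.exp_add]; ring_nf
  · obtain ⟨b, hb⟩ := exists_tendsto_exp_mul hpos (fun t _ => hy t) hT
    refine ⟨b, fun hμ => ?_, ?_⟩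
    · have h1 : Tendsto (fun t : ℝ => Complex.exp (-μ * t) * y t) atTop (𝓝 0) := by
        refine squeeze_zero_norm' ?_ (tendsto_zero_iff_norm_tendsto_zero.1 hy0)
        filter_upwards [eventually_ge_atTop 0] with t ht
        have h2 := norm_exp_ofReal_mul (-μ) (t : ℂ)
        push_cast at h2
        rw [norm_mul, h2, Complex.ofReal_re]
        refine mul_le_of_le_one_left (norm_nonneg _) (Real.exp_le_one_iff.2 (by nlinarith))
      exact tendsto_nhds_unique hb h1
    · have h3 : ∀ t : ℝ, HasDerivAt (fun t : ℝ => y t - b * Complex.exp (μ * t))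
          (μ * (y t - b * Complex.exp (μ * t)) + h t) t := by
        intro t
        have h2 : HasDerivAt (fun x : ℝ => (μ * x : ℂ)) μ t := by
          simpa using ((Complex.ofRealCLM.hasDerivAt (x := t)).const_mul (μ : ℂ))
        refine ((hy t).sub (h2.cexp.const_mul b)).congr_deriv ?_
        ring
      have h4 : Tendsto (fun t : ℝ => Complex.exp (-μ * t) * (y t - b * Complex.exp (μ * t)))
          atTop (𝓝 0) := by
        have h5 := hb.sub_const b
        rw [sub_self] at h5
        refine h5.congr fun t => ?_
        rw [mul_sub, mul_left_comm, ← Complex.exp_add]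
        simp
      refine Asymptotics.IsBigO.of_bound (H / (κ + μ)) ?_
      filter_upwards [eventually_ge_atTop T] with t ht
      simpa using norm_le_of_tendsto_zero hpos (fun t _ => h3 t) hT h4 ht

end ScalarODE

/-! ### Exponential decay in the hyperbolic system -/

/-- A solution of a perturbed hyperbolic diagonal system that tends to zero decays
exponentially. -/
theorem isBigO_exp_of_tendsto_zero {N : ℕ} {l : Fin N → ℝ} {a : ℝ} (ha : 0 < a)
    (hl : ∀ j, a ≤ |l j|) {u G : ℝ → Fin N → ℂ}
    (hu : ∀ t j, HasDerivAt (fun s => u s j) (l j * u t j + G t j) t)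
    (hG : ∀ ρ > 0, ∀ᶠ t in atTop, ‖G t‖ ≤ ρ * ‖u t‖) (hu0 : Tendsto u atTop (𝓝 0)) :
    u =O[atTop] fun t : ℝ => Real.exp (-(a / 2) * t) := by
  -- Then `N * ρ ≤ a / 4`, also for `N = 0`: summed over all coordinates, the perturbation costs at
  -- most a quarter of the gap.
  set ρ : ℝ := a / (4 * (N + 1)) with hρ
  have hρ0 : 0 < ρ := by positivity
  obtain ⟨T, hT⟩ := eventually_atTop.1 (hG ρ hρ0)
  set e : ℝ → Fin N → ℝ := fun t j => inner ℝ (u t j) (G t j) with he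
  have hd : ∀ t j, HasDerivAt (fun s => ‖u s j‖ ^ 2) (2 * (l j * ‖u t j‖ ^ 2 + e t j)) t := by
    intro t j
    refine (hu t j).norm_sq.congr_deriv ?_
    rw [inner_add_right, ← Complex.real_smul, real_inner_smul_right, real_inner_self_eq_norm_sq]
  have hW : ∀ (w : Fin N → ℝ) t, HasDerivAt (fun s => ∑ j, w j * ‖u s j‖ ^ 2)
      (∑ j, w j * (2 * (l j * ‖u t j‖ ^ 2 + e t j))) t := fun w t =>
    HasDerivAt.fun_sum fun j _ => (hd t j).const_mul (w j)
  set E : ℝ → ℝ := fun t => ∑ j, ‖u t j‖ ^ 2 with hE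
  have hE0 : ∀ t, 0 ≤ E t := fun t => Finset.sum_nonneg fun j _ => by positivity
  have huj : ∀ t j, ‖u t j‖ ^ 2 ≤ E t := fun t j =>
    Finset.single_le_sum (f := fun j => ‖u t j‖ ^ 2) (fun j _ => by positivity)
      (Finset.mem_univ j)
  have huE : ∀ t, ‖u t‖ ^ 2 ≤ E t := by
    intro t
    rw [← Real.le_sqrt (norm_nonneg _) (hE0 t)]
    refine (pi_norm_le_iff_of_nonneg (Real.sqrt_nonneg _)).2 fun j => ?_
    exact Real.le_sqrt_of_sq_le (huj t j)
  have heb : ∀ t, T ≤ t → ∑ j, |e t j| ≤ a / 4 * E t := by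
    intro t ht
    have h1 : ∀ j, |e t j| ≤ ρ * E t := by
      intro j
      calc |e t j| ≤ ‖u t j‖ * ‖G t j‖ := abs_real_inner_le_norm _ _
        _ ≤ ‖u t‖ * (ρ * ‖u t‖) := by
            gcongr
            · exact norm_le_pi_norm _ j
            · exact (norm_le_pi_norm _ j).trans (hT t ht)
        _ = ρ * ‖u t‖ ^ 2 := by ring
        _ ≤ ρ * E t := by gcongr; exact huE t
    calc ∑ j, |e t j| ≤ ∑ _j : Fin N, ρ * E t := Finset.sum_le_sum fun j _ => h1 j
      _ = N * ρ * E t := by simp [mul_assoc]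
      _ ≤ a / 4 * E t := by
          refine mul_le_mul_of_nonneg_right ?_ (hE0 t)
          rw [hρ, mul_div_assoc', div_le_div_iff₀ (by positivity) (by positivity)]
          nlinarith
  -- These signs define the form `Q`, unstable minus stable energy. It increases along the solution
  -- and tends to 0, so it is nonpositive: the stable energy `V` dominates and `E ≤ 2 * V`.
  set s : Fin N → ℝ := fun j => if 0 < l j then 1 else -1 with hs
  have hsl : ∀ j, s j * l j = |l j| := by
    intro j
    simp only [hs]
    split_ifs with h
    · rw [abs_of_pos h, one_mul]
    · rw [abs_of_nonpos (not_lt.1 h)]; ring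
  have hs1 : ∀ j, |s j| = 1 := by
    intro j
    simp only [hs]
    split_ifs <;> simp
  set Q : ℝ → ℝ := fun t => ∑ j, s j * ‖u t j‖ ^ 2 with hQ
  have hu0' : ∀ j, Tendsto (fun t => ‖u t j‖ ^ 2) atTop (𝓝 0) := fun j => by
    simpa using (tendsto_pi_nhds.1 hu0 j).norm.pow 2
  have hQ0 : Tendsto Q atTop (𝓝 0) := by
    simpa using tendsto_finsetSum Finset.univ fun j _ => (hu0' j).const_mul (s j)
  have hQneg : ∀ t, T ≤ t → Q t ≤ 0 := by
    have hmono : MonotoneOn Q (Set.Ici T) := by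
      refine monotoneOn_of_deriv_nonneg (convex_Ici T)
        (fun t _ => (hW s t).continuousAt.continuousWithinAt)
        (fun t _ => (hW s t).differentiableAt.differentiableWithinAt) fun t ht => ?_
      rw [interior_Ici] at ht
      rw [(hW s t).deriv]
      have h1 : ∑ j, (2 * a * ‖u t j‖ ^ 2 - 2 * |e t j|) ≤
          ∑ j, s j * (2 * (l j * ‖u t j‖ ^ 2 + e t j)) := by
        refine Finset.sum_le_sum fun j _ => ?_
        have h2 : -|e t j| ≤ s j * e t j := by
          have := neg_abs_le (s j * e t j)
          rwa [abs_mul, hs1, one_mul] at this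
        have h3 : a * ‖u t j‖ ^ 2 ≤ s j * l j * ‖u t j‖ ^ 2 := by
          rw [hsl]; gcongr; exact hl j
        linarith
      rw [Finset.sum_sub_distrib, ← Finset.mul_sum, ← Finset.mul_sum] at h1
      have h4 := heb t (le_of_lt ht)
      have h5 := mul_nonneg ha.le (hE0 t)
      change 2 * a * E t - _ ≤ _ at h1
      linarith
    intro t ht
    refine ge_of_tendsto hQ0 ?_
    filter_upwards [eventually_ge_atTop t] with t' ht'
    exact hmono ht (ht.trans ht') ht'
  set V : ℝ → ℝ := fun t => ∑ j, ((1 - s j) / 2) * ‖u t j‖ ^ 2 with hV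
  have hVE : ∀ t, E t = 2 * V t + Q t := by
    intro t
    simp only [hE, hV, hQ, Finset.mul_sum, ← Finset.sum_add_distrib]
    exact Finset.sum_congr rfl fun j _ => by ring
  -- The linear part contributes `-2 * a * V`; the perturbation at most `a / 2 * E ≤ a * V`.
  have hVd : ∀ t, T ≤ t → ∑ j, ((1 - s j) / 2) * (2 * (l j * ‖u t j‖ ^ 2 + e t j)) ≤
      -a * V t := by
    intro t ht
    have h1 : ∑ j, ((1 - s j) / 2) * (2 * (l j * ‖u t j‖ ^ 2 + e t j)) ≤
        ∑ j, (-2 * a * (((1 - s j) / 2) * ‖u t j‖ ^ 2) + 2 * |e t j|) := by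
      refine Finset.sum_le_sum fun j _ => ?_
      have h2 := hl j
      have h3 := le_abs_self (e t j)
      simp only [hs]
      split_ifs with h
      · simp
      · rw [abs_of_nonpos (not_lt.1 h)] at h2
        have : l j * ‖u t j‖ ^ 2 ≤ -a * ‖u t j‖ ^ 2 := by gcongr; linarith
        norm_num
        linarith
    rw [Finset.sum_add_distrib, ← Finset.mul_sum, ← Finset.mul_sum] at h1
    change _ ≤ -2 * a * V t + _ at h1
    have h4 := heb t ht
    have h5 := hQneg t ht
    have h6 := hVE t
    nlinarith
  have hanti : AntitoneOn (fun t => V t * Real.exp (a * t)) (Set.Ici T) := by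
    have hd' : ∀ t, HasDerivAt (fun t => V t * Real.exp (a * t)) _ t := fun t =>
      (hW _ t).mul (((hasDerivAt_id t).const_mul a).exp)
    refine antitoneOn_of_deriv_nonpos (convex_Ici T)
      (fun t _ => (hd' t).continuousAt.continuousWithinAt)
      (fun t _ => (hd' t).differentiableAt.differentiableWithinAt) fun t ht => ?_
    rw [interior_Ici] at ht
    rw [(hd' t).deriv]
    have h1 := mul_le_mul_of_nonneg_right (hVd t (le_of_lt ht)) (Real.exp_pos (a * t)).le
    change _ + V t * _ ≤ 0
    simp only [id, mul_one]
    linarith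
  refine Asymptotics.IsBigO.of_bound (Real.sqrt (2 * (V T * Real.exp (a * T)))) ?_
  filter_upwards [eventually_ge_atTop T] with t ht
  have h1 := hanti (Set.mem_Ici.2 le_rfl) (Set.mem_Ici.2 ht) ht
  have h2 : ‖u t‖ ^ 2 ≤ 2 * (V T * Real.exp (a * T)) * Real.exp (-(a / 2) * t) ^ 2 := by
    have h3 : Real.exp (a * t) * Real.exp (-(a / 2) * t) ^ 2 = 1 := by
      rw [← Real.exp_nat_mul, ← Real.exp_add, Real.exp_eq_one_iff]; push_cast; ring
    calc ‖u t‖ ^ 2 ≤ E t := huE t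
      _ ≤ 2 * V t := by rw [hVE]; linarith [hQneg t ht]
      _ = 2 * (V t * Real.exp (a * t)) * Real.exp (-(a / 2) * t) ^ 2 := by
          rw [mul_assoc, mul_assoc, h3, mul_one]
      _ ≤ _ := by gcongr
  rw [Real.norm_eq_abs, Real.abs_exp]
  refine abs_le_of_sq_le_sq' ?_ (by positivity) |>.2
  rw [mul_pow, Real.sq_sqrt]
  · exact h2
  · by_contra h4
    have : 2 * (V T * Real.exp (a * T)) * Real.exp (-(a / 2) * t) ^ 2 < 0 :=
      mul_neg_of_neg_of_pos (not_le.1 h4) (by positivity)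
    nlinarith [sq_nonneg ‖u t‖]

/-- Integration from infinity along horizontal rays, the scalar estimate with `μ = 0`; its constants
do not depend on the height of the ray. -/
theorem isBigO_atRight_of_deriv {D D' : ℂ → ℂ} {κ : ℝ} (hκ : 0 < κ)
    (hD : ∀ z, HasDerivAt D (D' z) z)
    (hD' : D' =O[atRight] fun z : ℂ => Real.exp (-κ * z.re)) (hD0 : Tendsto D atRight (𝓝 0)) :
    D =O[atRight] fun z : ℂ => Real.exp (-κ * z.re) := by
  obtain ⟨C, hC, hb⟩ := hD'.exists_pos
  obtain ⟨T, hT⟩ := eventually_atRight.1 hb.bound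
  refine Asymptotics.IsBigO.of_bound (C / (κ + 0)) (eventually_atRight.2 ⟨T, fun z hz => ?_⟩)
  have hline : ∀ t : ℝ, HasDerivAt (fun t : ℝ => D (t + z.im * Complex.I))
      ((0 : ℝ) * D (t + z.im * Complex.I) + D' (t + z.im * Complex.I)) t := by
    intro t
    have h1 : HasDerivAt (fun t : ℝ => (t + z.im * Complex.I : ℂ)) 1 t :=
      (Complex.ofRealCLM.hasDerivAt (x := t)).add_const _
    have h2 := (hD (t + z.im * Complex.I)).scomp t h1
    simpa [Function.comp_def] using! h2
  have h3 := norm_le_of_tendsto_zero (y := fun t : ℝ => D (t + z.im * Complex.I))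
    (h := fun t : ℝ => D' (t + z.im * Complex.I)) (μ := 0) (κ := κ) (H := C) (T := T)
    (by linarith) (fun t _ => hline t) (fun t ht => ?_) ?_ hz
  · rw [Complex.re_add_im] at h3
    simpa using h3
  · simpa using hT (t + z.im * Complex.I) (by simpa using ht)
  · have h4 : Tendsto (fun t : ℝ => (t + z.im * Complex.I : ℂ)) atTop atRight :=
      tendsto_comap_iff.2 (by simpa [Function.comp_def] using! tendsto_id)
    simpa using! hD0.comp h4

/-! ### Entire functions of exponential sums -/

section Composition

theorem add_mem_stableExponents_two {N : ℕ} {l : Fin N → ℝ} {a b : ℝ}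
    (ha : a ∈ stableExponents l 1) (hb : b ∈ stableExponents l 1) :
    a + b ∈ stableExponents l 2 :=
  stableExponents_anti l (m' := 1 + 1) le_rfl (add_mem_stableExponents ha hb)

variable {N : ℕ} {l : Fin N → ℝ} {c : ℝ} {p : ℂ → Fin N → ℂ}

theorem tendsto_zero_atRight_of_mem_expSpan {S : Set ℝ} (hc : 0 < c) (hS : ∀ ν ∈ S, ν ≤ -c)
    {φ : ℂ → ℂ} (hφ : φ ∈ expSpan S) : Tendsto φ atRight (𝓝 0) :=
  (isBigO_of_mem_expSpan hS hφ).trans_tendsto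
    ((tendsto_exp_neg_mul_atTop hc).comp tendsto_re_atRight)

theorem fderiv_apply_eq_sum (F : (Fin N → ℂ) → ℂ) (x y : Fin N → ℂ) :
    fderiv ℂ F x y = ∑ i, y i * fderiv ℂ F x (Pi.single i 1) := by
  conv_lhs => rw [pi_eq_sum_univ' y]
  simp [map_sum]

/-- By the chain rule, expansions of the partial derivatives along `p`, multiplied by `p'`, expand
the derivative of `F ∘ p`. The factor `p'` gains the rate `c`, and integration is possible within
the span because 0 is not an exponent. -/
theorem exists_expansion_of_fderiv (hc : 0 < c) {κ : ℝ} (hκ : 0 < κ + c) {S U : Set ℝ}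
    (hS : ∀ ν ∈ S, ν ≤ -c) (hU : ∀ ν ∈ U, ν ≤ -c) {F : (Fin N → ℂ) → ℂ}
    (hF : Differentiable ℂ F) {p' : ℂ → Fin N → ℂ} {q : Fin N → ℂ → ℂ}
    (hpS : ∀ i, (fun z => p z i) ∈ expSpan S) (hp'S : ∀ i, (fun z => p' z i) ∈ expSpan S)
    (hp : ∀ z, HasDerivAt p (p' z) z)
    (hq : ∀ i, (fun z => fderiv ℂ F (p z) (Pi.single i 1) - fderiv ℂ F 0 (Pi.single i 1) - q i z)
      =O[atRight] fun z : ℂ => Real.exp (-κ * z.re))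
    (hQ : ∀ i, (fun z => (fderiv ℂ F 0 (Pi.single i 1) + q i z) * p' z i) ∈ expSpan U) :
    ∃ Q ∈ expSpan U, (fun z => F (p z) - F 0 - Q z)
      =O[atRight] fun z : ℂ => Real.exp (-(κ + c) * z.re) := by
  have h0 : (0 : ℝ) ∉ U := fun h => by linarith [hU 0 h]
  obtain ⟨Q, hQU, hQd⟩ := exists_solution_mem_expSpan h0
    (sum_mem (t := Finset.univ) fun i _ => hQ i)
  refine ⟨Q, hQU, ?_⟩
  refine isBigO_atRight_of_deriv (D' := fun z => ∑ i,
    (fderiv ℂ F (p z) (Pi.single i 1) - fderiv ℂ F 0 (Pi.single i 1) - q i z) * p' z i)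
    hκ (fun z => ?_) ?_ ?_
  · have h1 := ((hF (p z)).hasFDerivAt.comp_hasDerivAt z (hp z)).sub_const (F 0)
    refine (h1.sub (hQd z)).congr_deriv ?_
    rw [fderiv_apply_eq_sum, Finset.sum_apply]
    simp only [Complex.ofReal_zero, zero_mul, zero_add]
    rw [← Finset.sum_sub_distrib]
    exact Finset.sum_congr rfl fun i _ => by ring
  · refine Asymptotics.IsBigO.fun_sum fun i _ => ?_
    refine ((hq i).mul (isBigO_of_mem_expSpan hS (hp'S i))).congr_right fun z => ?_
    rw [← Real.exp_add]; ring_nf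
  · have h1 : Tendsto p atRight (𝓝 0) :=
      tendsto_pi_nhds.2 fun i => tendsto_zero_atRight_of_mem_expSpan hc hS (hpS i)
    have h2 := (((hF.continuous.tendsto 0).comp h1).sub_const (F 0)).sub
      (tendsto_zero_atRight_of_mem_expSpan hc hU hQU)
    simpa using! h2

/-- An entire function of decaying exponential sums is an exponential sum, up to an error of
any given exponential order. -/
theorem exists_expansion_comp (hc : 0 < c) (hS : ∀ ν ∈ stableExponents l 1, ν ≤ -c)
    (hpS : ∀ i, (fun z => p z i) ∈ expSpan (stableExponents l 1)) (M : ℕ)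
    {F : (Fin N → ℂ) → ℂ} (hF : Differentiable ℂ F) :
    ∃ Q ∈ expSpan (stableExponents l 1), (fun z => F (p z) - F 0 - Q z)
      =O[atRight] fun z : ℂ => Real.exp (-(M * c) * z.re) := by
  choose p' hp'S hp using fun i => exists_hasDerivAt_of_mem_expSpan (hpS i)
  induction M generalizing F with
  | zero =>
    refine ⟨0, zero_mem _, ?_⟩
    have h1 : Tendsto p atRight (𝓝 0) :=
      tendsto_pi_nhds.2 fun i => tendsto_zero_atRight_of_mem_expSpan hc hS (hpS i)
    have h2 := ((hF.continuous.tendsto 0).comp h1).sub_const (F 0)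
    simpa using! h2.isBigO_one ℝ
  | succ M ih =>
    choose q hqS hq using fun i : Fin N =>
      ih (differentiable_fderiv_apply hF (Pi.single i (1 : ℂ)))
    have h := exists_expansion_of_fderiv (κ := M * c) hc (by positivity) hS hS hF
      (p' := fun z i => p' i z) (q := q) hpS hp'S (fun z => hasDerivAt_pi.2 fun i => hp i z) hq
      (fun i => ?_)
    · convert h using 6
      push_cast; ring
    · have h2 : (fun z => (fderiv ℂ F 0 (Pi.single i 1) + q i z) * p' i z) =
          (fderiv ℂ F 0 (Pi.single i 1)) • p' i + q i * p' i := by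
        ext z; simp [add_mul]
      rw [h2]
      refine add_mem (Submodule.smul_mem _ _ (hp'S i)) (mul_mem_expSpan (fun a ha b hb => ?_)
        (hqS i) (hp'S i))
      exact stableExponents_anti l one_le_two (add_mem_stableExponents ha hb)

/-- Without the linear part of `F`, the expanded derivative contains only products `q i * p' i` of
two sums of order at least one. Hence all exponents have order at least two, which is where
nonresonance applies. -/
theorem exists_expansion_comp_of_fderiv_zero (hc : 0 < c)
    (hS : ∀ ν ∈ stableExponents l 1, ν ≤ -c)
    (hpS : ∀ i, (fun z => p z i) ∈ expSpan (stableExponents l 1)) (K : ℝ)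
    {F : (Fin N → ℂ) → ℂ} (hF : Differentiable ℂ F) (hF0 : F 0 = 0) (hF' : fderiv ℂ F 0 = 0) :
    ∃ Q ∈ expSpan (stableExponents l 2), (fun z => F (p z) - Q z)
      =O[atRight] fun z : ℂ => Real.exp (-K * z.re) := by
  obtain ⟨M, hM⟩ := exists_nat_ge (K / c)
  rw [div_le_iff₀ hc] at hM
  choose p' hp'S hp using fun i => exists_hasDerivAt_of_mem_expSpan (hpS i)
  choose q hqS hq using fun i : Fin N =>
    exists_expansion_comp hc hS hpS M (differentiable_fderiv_apply hF (Pi.single i (1 : ℂ)))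
  obtain ⟨Q, h1, h2⟩ := exists_expansion_of_fderiv (κ := M * c) hc (by positivity) hS
    (fun ν hν => hS ν (stableExponents_anti l one_le_two hν)) hF
    (p' := fun z i => p' i z) (q := q) hpS hp'S (fun z => hasDerivAt_pi.2 fun i => hp i z) hq
    (U := stableExponents l 2) (fun i => by
      have h3 : q i * p' i ∈ expSpan (stableExponents l 2) :=
        mul_mem_expSpan (fun a ha b hb => add_mem_stableExponents_two ha hb) (hqS i) (hp'S i)
      have h4 : (fun z => (fderiv ℂ F 0 (Pi.single i 1) + q i z) * p' i z) = q i * p' i := by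
        ext z; simp [hF']
      rwa [h4])
  refine ⟨Q, h1, ?_⟩
  simp only [hF0, sub_zero] at h2
  exact h2.trans (isBigO_exp_re_of_le (by linarith))

end Composition

/-! ### Asymptotic expansion of a diagonal orbit -/

/-- The nonlinear part of a vector field at the origin. -/
noncomputable def nonlinearPart {N : ℕ} (F : (Fin N → ℂ) → (Fin N → ℂ)) (x : Fin N → ℂ) :
    Fin N → ℂ :=
  F x - fderiv ℂ F 0 x

/-- A complex entire solution of an entire vector field with diagonal, hyperbolic, nonresonant
real linearization at the origin, which tends to the origin as real time goes to `+∞`. -/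
structure IsDiagonalOrbit {N : ℕ} (l : Fin N → ℝ) (F : (Fin N → ℂ) → (Fin N → ℂ))
    (u : ℂ → Fin N → ℂ) : Prop where
  entire : Differentiable ℂ F
  zero : F 0 = 0
  linear : ∀ x j, fderiv ℂ F 0 x j = l j * x j
  ne_zero : ∀ j, l j ≠ 0
  nonresonant : ∀ j, l j ∉ stableExponents l 2
  solution : ∀ z, HasDerivAt u (F (u z)) z
  tendsto_zero : Tendsto (fun t : ℝ => u t) atTop (𝓝 0)

theorem exists_pos_le_abs {N : ℕ} {l : Fin N → ℝ} (hl : ∀ j, l j ≠ 0) :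
    ∃ a > 0, ∀ j, a ≤ |l j| := by
  rcases isEmpty_or_nonempty (Fin N) with h | h
  · exact ⟨1, one_pos, fun j => isEmptyElim j⟩
  · obtain ⟨j₀, hj₀⟩ := Finite.exists_min fun j => |l j|
    exact ⟨|l j₀|, abs_pos.2 (hl j₀), hj₀⟩

namespace IsDiagonalOrbit

variable {N : ℕ} {l : Fin N → ℝ} {F : (Fin N → ℂ) → (Fin N → ℂ)} {u : ℂ → Fin N → ℂ}

theorem differentiable_nonlinearPart (h : IsDiagonalOrbit l F u) :
    Differentiable ℂ (nonlinearPart F) :=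
  h.entire.sub (fderiv ℂ F 0).differentiable

theorem nonlinearPart_zero (h : IsDiagonalOrbit l F u) : nonlinearPart F 0 = 0 := by
  simp [nonlinearPart, h.zero]

theorem hasFDerivAt_nonlinearPart (h : IsDiagonalOrbit l F u) :
    HasFDerivAt (nonlinearPart F) (0 : (Fin N → ℂ) →L[ℂ] (Fin N → ℂ)) 0 := by
  have h1 := (h.entire 0).hasFDerivAt.sub (fderiv ℂ F 0).hasFDerivAt (x := 0)
  rwa [sub_self] at h1

theorem apply_eq (h : IsDiagonalOrbit l F u) (x : Fin N → ℂ) (j : Fin N) :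
    F x j = l j * x j + nonlinearPart F x j := by
  simp [nonlinearPart, h.linear]

theorem exists_quadratic_bound (h : IsDiagonalOrbit l F u) :
    ∃ C > 0, ∃ δ > 0, ∀ r ≤ δ, ∀ x y, ‖x‖ ≤ r → ‖y‖ ≤ r →
      ‖nonlinearPart F x - nonlinearPart F y‖ ≤ C * r * ‖x - y‖ :=
  exists_norm_sub_le_mul_of_fderiv_zero h.differentiable_nonlinearPart
    h.hasFDerivAt_nonlinearPart.fderiv

theorem isBigO_nonlinearPart_sub (h : IsDiagonalOrbit l F u) {α : Type*} {L : Filter α}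
    {x y : α → Fin N → ℂ} (hx : Tendsto x L (𝓝 0)) (hy : Tendsto y L (𝓝 0)) :
    (fun a => nonlinearPart F (x a) - nonlinearPart F (y a)) =O[L]
      fun a => (‖x a‖ + ‖y a‖) * ‖x a - y a‖ := by
  obtain ⟨C, hC, δ, hδ, hq⟩ := h.exists_quadratic_bound
  have h1 : Tendsto (fun a => ‖x a‖ + ‖y a‖) L (𝓝 0) := by
    simpa using hx.norm.add hy.norm
  refine Asymptotics.IsBigO.of_bound C ?_
  filter_upwards [h1.eventually_le_const hδ] with a ha
  refine (hq _ ha (x a) (y a) (by simp) (by simp)).trans_eq ?_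
  rw [Real.norm_of_nonneg (by positivity), mul_assoc]

theorem hasDerivAt_real (h : IsDiagonalOrbit l F u) (t : ℝ) (j : Fin N) :
    HasDerivAt (fun s : ℝ => u s j) (l j * u t j + nonlinearPart F (u t) j) t := by
  rw [← h.apply_eq]
  exact (hasDerivAt_pi.1 (h.solution t) j).comp_ofReal

theorem exists_rate (h : IsDiagonalOrbit l F u) :
    ∃ c > 0, (∀ ν ∈ stableExponents l 1, ν ≤ -c) ∧
      (fun t : ℝ => u t) =O[atTop] fun t : ℝ => Real.exp (-c * t) := by
  obtain ⟨a, ha, hl⟩ := exists_pos_le_abs h.ne_zero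
  refine ⟨a / 2, by positivity, fun ν hν =>
    (le_of_mem_stableExponents ha hl hν).trans (by linarith), ?_⟩
  refine isBigO_exp_of_tendsto_zero ha hl (u := fun t : ℝ => u t)
    (G := fun t : ℝ => nonlinearPart F (u t)) h.hasDerivAt_real (fun ρ hρ => ?_) h.tendsto_zero
  have h1 := h.hasFDerivAt_nonlinearPart.isLittleO.bound hρ
  have h2 := h.tendsto_zero.eventually h1
  filter_upwards [h2] with t ht
  simpa [h.nonlinearPart_zero] using ht

/-- One step of the asymptotic expansion improves the error by the spectral gap `c`. -/
theorem exists_improved_expansion (h : IsDiagonalOrbit l F u) {c κ κ' : ℝ} (hc : 0 < c)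
    (hS : ∀ ν ∈ stableExponents l 1, ν ≤ -c)
    (hu : (fun t : ℝ => u t) =O[atTop] fun t : ℝ => Real.exp (-c * t))
    (hκ' : κ' ≤ κ + c) (hne : ∀ j, κ' + l j ≠ 0) {p : ℂ → Fin N → ℂ}
    (hpS : ∀ i, (fun z => p z i) ∈ expSpan (stableExponents l 1))
    (hp : (fun t : ℝ => u t - p t) =O[atTop] fun t : ℝ => Real.exp (-κ * t)) :
    ∃ p₁ q : ℂ → Fin N → ℂ, (∀ i, (fun z => p₁ z i) ∈ expSpan (stableExponents l 1)) ∧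
      (∀ z i, HasDerivAt (fun z => p₁ z i) (l i * p₁ z i + q z i) z) ∧
      (fun z => nonlinearPart F (p z) - q z)
        =O[atRight] (fun z : ℂ => Real.exp (-κ' * z.re)) ∧
      (fun t : ℝ => u t - p₁ t) =O[atTop] fun t : ℝ => Real.exp (-κ' * t) := by
  have hgi : ∀ i, Differentiable ℂ fun x => nonlinearPart F x i := fun i =>
    differentiable_pi.1 h.differentiable_nonlinearPart i
  choose q hqS hq using fun i => exists_expansion_comp_of_fderiv_zero hc hS hpS κ' (hgi i)
    (by rw [h.nonlinearPart_zero]; rfl) ((hasFDerivAt_pi'.1 h.hasFDerivAt_nonlinearPart i).fderiv.trans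
      (ContinuousLinearMap.comp_zero _))
  -- `w` absorbs the expanded nonlinearity; this is the use of nonresonance. The difference `u - w`
  -- then solves a linear equation with forcing of order `exp (-κ' t)`, so it is `b * exp (l t)` up
  -- to that order, with `b = 0` in unstable directions.
  choose w hwS hw using fun i => exists_solution_mem_expSpan (h.nonresonant i) (hqS i)
  have hp0 : Tendsto p atRight (𝓝 0) :=
    tendsto_pi_nhds.2 fun i => tendsto_zero_atRight_of_mem_expSpan hc hS (hpS i)
  have hpr0 := hp0.comp tendsto_ofReal_atRight
  have hpc : p =O[atRight] fun z : ℂ => Real.exp (-c * z.re) :=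
    Asymptotics.isBigO_pi.2 fun i => isBigO_of_mem_expSpan hS (hpS i)
  have hpcr : (fun t : ℝ => p t) =O[atTop] fun t : ℝ => Real.exp (-c * t) := by
    simpa [Function.comp_def] using! hpc.comp_tendsto tendsto_ofReal_atRight
  have hgup : (fun t : ℝ => nonlinearPart F (u t) - nonlinearPart F (p t)) =O[atTop]
      fun t : ℝ => Real.exp (-κ' * t) := by
    refine (h.isBigO_nonlinearPart_sub h.tendsto_zero hpr0).trans ?_
    refine ((hu.norm_left.add hpcr.norm_left).mul hp.norm_left).trans ?_
    refine Asymptotics.IsBigO.trans ?_ (isBigO_exp_of_le hκ')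
    refine Asymptotics.IsBigO.of_norm_le fun t => ?_
    rw [← Real.exp_add, Real.norm_eq_abs, Real.abs_exp]
    exact Real.exp_le_exp.2 (by linarith)
  have hy : ∀ i, ∃ b : ℂ, (0 ≤ l i → b = 0) ∧
      (fun t : ℝ => u t i - w i t - b * Complex.exp (l i * t)) =O[atTop]
        fun t : ℝ => Real.exp (-κ' * t) := by
    intro i
    refine exists_isBigO_sub_const_mul_exp (y := fun t : ℝ => u t i - w i t) (hne i)
      (h := fun t : ℝ => (nonlinearPart F (u t) i - nonlinearPart F (p t) i) +
        (nonlinearPart F (p t) i - q i t)) (fun t => ?_) ?_ ?_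
    · refine ((h.hasDerivAt_real t i).sub (hw i t).comp_ofReal).congr_deriv ?_
      ring
    · refine (Asymptotics.isBigO_pi.1 hgup i).add ?_
      simpa [Function.comp_def] using! (hq i).comp_tendsto tendsto_ofReal_atRight
    · have h1 := (tendsto_zero_atRight_of_mem_expSpan hc (fun ν hν =>
        hS ν (stableExponents_anti l one_le_two hν)) (hwS i)).comp tendsto_ofReal_atRight
      simpa using! (tendsto_pi_nhds.1 h.tendsto_zero i).sub h1
  choose b hb0 hb using hy
  refine ⟨fun z i => w i z + b i * Complex.exp (l i * z), fun z i => q i z, fun i => ?_,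
    fun z i => ?_, Asymptotics.isBigO_pi.2 hq, Asymptotics.isBigO_pi.2 fun i => ?_⟩
  · refine add_mem (expSpan_mono (stableExponents_anti l one_le_two) (hwS i)) ?_
    rcases lt_or_ge (l i) 0 with hi | hi
    · exact Submodule.smul_mem _ (b i) (exp_mem_expSpan (mem_stableExponents_one hi))
    · simp only [hb0 i hi, zero_mul]
      exact zero_mem _
  · refine ((hw i z).add
      ((((hasDerivAt_id z).const_mul (l i : ℂ)).cexp).const_mul (b i))).congr_deriv ?_
    simp only [id, mul_one]
    ring
  · refine (hb i).congr_left fun t => ?_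
    simp only [Pi.sub_apply]
    ring

theorem exists_real_expansion (h : IsDiagonalOrbit l F u) (K : ℝ) :
    ∃ p : ℂ → Fin N → ℂ, (∀ i, (fun z => p z i) ∈ expSpan (stableExponents l 1)) ∧
      (fun t : ℝ => u t - p t) =O[atTop] fun t : ℝ => Real.exp (-K * t) := by
  obtain ⟨c, hc, hS, hu⟩ := h.exists_rate
  have key : ∀ n : ℕ, ∃ p : ℂ → Fin N → ℂ,
      (∀ i, (fun z => p z i) ∈ expSpan (stableExponents l 1)) ∧
      (fun t : ℝ => u t - p t) =O[atTop] fun t : ℝ => Real.exp (-(n * (c / 2)) * t) := by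
    intro n
    induction n with
    | zero =>
      refine ⟨0, fun i => zero_mem _, ?_⟩
      simpa using! hu.trans (isBigO_exp_of_le hc.le)
    | succ n ih =>
      obtain ⟨p, hpS, hp⟩ := ih
      -- A step could gain `c`; settling for at least `c / 2` leaves an interval of rates in which
      -- to avoid the finitely many values `-l j`.
      obtain ⟨κ', hκ', hne⟩ := (Set.Icc_infinite (show n * (c / 2) + c / 2 < n * (c / 2) + c by
        linarith)).exists_notMem_finset (Finset.univ.image fun j => -l j)
      obtain ⟨p₁, q, h1, -, -, h2⟩ := h.exists_improved_expansion hc hS hu hκ'.2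
        (fun j hj => hne (Finset.mem_image.2 ⟨j, Finset.mem_univ j, by linarith⟩)) hpS hp
      refine ⟨p₁, h1, h2.trans (isBigO_exp_of_le ?_)⟩
      push_cast
      linarith [hκ'.1]
  obtain ⟨n, hn⟩ := exists_nat_ge (K / (c / 2))
  rw [div_le_iff₀ (by positivity)] at hn
  obtain ⟨p, h1, h2⟩ := key n
  exact ⟨p, h1, h2.trans (isBigO_exp_of_le hn)⟩

/-- Up to any exponential order, the orbit is an exponential sum that solves the equation on a
right half-plane. -/
theorem exists_approximate_solution (h : IsDiagonalOrbit l F u) (K : ℝ) :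
    ∃ p r : ℂ → Fin N → ℂ, (∀ i, (fun z => p z i) ∈ expSpan (stableExponents l 1)) ∧
      (∀ z, HasDerivAt p (F (p z) - r z) z) ∧
      r =O[atRight] (fun z : ℂ => Real.exp (-K * z.re)) ∧
      (fun t : ℝ => u t - p t) =O[atTop] fun t : ℝ => Real.exp (-K * t) := by
  obtain ⟨c, hc, hS, hu⟩ := h.exists_rate
  obtain ⟨p, hpS, hp⟩ := h.exists_real_expansion K
  obtain ⟨κ', hκ', hne⟩ := (Set.Icc_infinite (show K < K + c by
    linarith)).exists_notMem_finset (Finset.univ.image fun j => -l j)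
  obtain ⟨p₁, q, h1, h2, h3, h4⟩ := h.exists_improved_expansion hc hS hu hκ'.2
    (fun j hj => hne (Finset.mem_image.2 ⟨j, Finset.mem_univ j, by linarith⟩)) hpS hp
  have h4' := h4.trans (isBigO_exp_of_le hκ'.1)
  have hp0 : Tendsto p atRight (𝓝 0) :=
    tendsto_pi_nhds.2 fun i => tendsto_zero_atRight_of_mem_expSpan hc hS (hpS i)
  have hp10 : Tendsto p₁ atRight (𝓝 0) :=
    tendsto_pi_nhds.2 fun i => tendsto_zero_atRight_of_mem_expSpan hc hS (h1 i)
  -- Both sums approximate `u` on the real axis, so their difference is small there, and for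
  -- exponential sums this extends to the half-plane. It lets `q`, an expansion along `p`, serve for
  -- `p₁`.
  have hdiff : (fun z => p₁ z - p z) =O[atRight] fun z : ℂ => Real.exp (-K * z.re) := by
    refine Asymptotics.isBigO_pi.2 fun i =>
      isBigO_atRight_of_isBigO_real (sub_mem (h1 i) (hpS i)) ?_
    have h5 := Asymptotics.isBigO_pi.1 (hp.sub h4') i
    simpa using! h5
  refine ⟨p₁, fun z => nonlinearPart F (p₁ z) - q z, h1, fun z => ?_, ?_, h4'⟩
  · refine hasDerivAt_pi.2 fun i => (h2 z i).congr_deriv ?_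
    simp only [Pi.sub_apply, h.apply_eq]
    ring
  · have h6 : (fun z => nonlinearPart F (p₁ z) - nonlinearPart F (p z)) =O[atRight]
        fun z : ℂ => Real.exp (-K * z.re) := by
      refine (h.isBigO_nonlinearPart_sub hp10 hp0).trans ?_
      have h7 : Tendsto (fun z => ‖p₁ z‖ + ‖p z‖) atRight (𝓝 (‖(0 : Fin N → ℂ)‖ + ‖(0 : Fin N → ℂ)‖)) :=
        hp10.norm.add hp0.norm
      simpa using (h7.isBigO_one ℝ).mul hdiff.norm_left
    refine (h6.add (h3.trans (isBigO_exp_re_of_le hκ'.1))).congr_left fun z => ?_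
    abel

end IsDiagonalOrbit

/-! ### Continuation of the approximation to a half-plane -/

namespace IsDiagonalOrbit

variable {N : ℕ} {l : Fin N → ℝ} {F : (Fin N → ℂ) → (Fin N → ℂ)} {u : ℂ → Fin N → ℂ}

section Bootstrap

variable {p r : ℂ → Fin N → ℂ} {K C T Λ : ℝ}

/-- Along a horizontal ray, an a priori bound on the error of the approximate solution improves. -/
theorem norm_sub_le_on_ray (h : IsDiagonalOrbit l F u) (hΛ : ∀ j, |l j| ≤ Λ) (hK : Λ + 1 ≤ K)
    (hC : 0 < C) (hp : ∀ z, HasDerivAt p (F (p z) - r z) z)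
    (herr : ∀ z : ℂ, T ≤ z.re → ‖u z - p z‖ ≤ 2 * (2 * C) * Real.exp (-K * z.re) →
      ‖nonlinearPart F (u z) - nonlinearPart F (p z) + r z‖ ≤ 2 * C * Real.exp (-K * z.re))
    (s : ℝ)
    (hb : ∀ t : ℝ, T ≤ t → ‖u (t + s * Complex.I) - p (t + s * Complex.I)‖ ≤
      2 * (2 * C) * Real.exp (-K * t)) (t : ℝ) (ht : T ≤ t) :
    ‖u (t + s * Complex.I) - p (t + s * Complex.I)‖ ≤ 2 * C * Real.exp (-K * t) := by
  refine (pi_norm_le_iff_of_nonneg (by positivity)).2 fun j => ?_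
  -- This makes integration from infinity lose no constant, and makes the a priori bound strong
  -- enough to remove the homogeneous solution.
  have hpos : 1 ≤ K + l j := by linarith [neg_abs_le (l j), hΛ j]
  have hd : ∀ x : ℝ, HasDerivAt
      (fun x : ℝ => u (x + s * Complex.I) j - p (x + s * Complex.I) j)
      (l j * (u (x + s * Complex.I) j - p (x + s * Complex.I) j) +
        (nonlinearPart F (u (x + s * Complex.I)) - nonlinearPart F (p (x + s * Complex.I)) +
          r (x + s * Complex.I)) j) x := by
    intro x
    have h1 : HasDerivAt (fun t : ℝ => (t + s * Complex.I : ℂ)) 1 x :=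
      (Complex.ofRealCLM.hasDerivAt (x := x)).add_const _
    have h2 := ((hasDerivAt_pi.1 (h.solution (x + s * Complex.I)) j).sub
      (hasDerivAt_pi.1 (hp (x + s * Complex.I)) j)).scomp x h1
    refine h2.congr_deriv ?_
    simp only [Pi.sub_apply, Pi.add_apply, h.apply_eq, one_smul]
    ring
  have h3 := norm_le_of_tendsto_zero (T := T) (κ := K) (H := 2 * C) (by linarith)
    (fun x _ => hd x) (fun x hx => ?_) ?_ ht
  · refine h3.trans ?_
    gcongr
    exact div_le_self (by positivity) hpos
  · refine (norm_le_pi_norm _ j).trans ?_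
    simpa using herr (x + s * Complex.I) (by simpa using hx) (by simpa using hb x hx)
  · refine squeeze_zero_norm' (a := fun t : ℝ => 2 * (2 * C) * Real.exp (-(K + l j) * t)) ?_ ?_
    · filter_upwards [eventually_ge_atTop T] with x hx
      have h2 := norm_exp_ofReal_mul (-l j) (x : ℂ)
      push_cast at h2
      rw [norm_mul, h2, Complex.ofReal_re]
      calc _ ≤ Real.exp (-l j * x) * (2 * (2 * C) * Real.exp (-K * x)) := by
            gcongr
            exact (norm_le_pi_norm (u (x + s * Complex.I) - p (x + s * Complex.I)) j).trans
              (hb x hx)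
        _ = _ := by rw [mul_left_comm, ← Real.exp_add]; ring_nf
    · simpa using (tendsto_exp_neg_mul_atTop (κ := K + l j) (by linarith)).const_mul (2 * (2 * C))

/-- In the imaginary direction, the error at most doubles over a fixed length. -/
theorem norm_sub_le_vertical (h : IsDiagonalOrbit l F u) (hΛ0 : 0 ≤ Λ) (hΛ : ∀ j, |l j| ≤ Λ)
    (hC : 0 < C) (hp : ∀ z, HasDerivAt p (F (p z) - r z) z)
    (herr : ∀ z : ℂ, T ≤ z.re → ‖u z - p z‖ ≤ 2 * (2 * C) * Real.exp (-K * z.re) →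
      ‖nonlinearPart F (u z) - nonlinearPart F (p z) + r z‖ ≤ 2 * C * Real.exp (-K * z.re))
    {σ : ℝ} (hσ : |σ| = 1) {t s₀ s : ℝ} (ht : T ≤ t) (hs : s₀ ≤ s)
    (hs' : (2 * Λ + 2) * (s - s₀) ≤ 1)
    (hb : ‖u (t + (σ * s₀ : ℝ) * Complex.I) - p (t + (σ * s₀ : ℝ) * Complex.I)‖ ≤
      2 * C * Real.exp (-K * t)) :
    ‖u (t + (σ * s : ℝ) * Complex.I) - p (t + (σ * s : ℝ) * Complex.I)‖ ≤
      2 * (2 * C) * Real.exp (-K * t) := by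
  set m : ℝ := 2 * C * Real.exp (-K * t) with hm
  have hm0 : 0 < m := by positivity
  have h2m : 2 * (2 * C) * Real.exp (-K * t) = 2 * m := by rw [hm]; ring
  rw [h2m]
  set γ : ℝ → ℂ := fun x => t + (σ * x : ℝ) * Complex.I with hγ
  have hγre : ∀ x, (γ x).re = t := fun x => by simp [hγ]
  have hγd : ∀ x, HasDerivAt γ (σ * Complex.I) x := by
    intro x
    have h1 : HasDerivAt (fun x : ℝ => (((σ * x : ℝ) : ℂ))) σ x := by
      simpa using (((hasDerivAt_id x).const_mul σ).ofReal_comp)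
    exact (h1.mul_const Complex.I).const_add _
  have hd : ∀ x, HasDerivAt (fun x => u (γ x) - p (γ x))
      ((σ * Complex.I) • (F (u (γ x)) - (F (p (γ x)) - r (γ x)))) x := fun x =>
    ((h.solution (γ x)).sub (hp (γ x))).scomp x (hγd x)
  -- The linear barrier rises from `m` to at most `2 * m`. Where the error touches it, the error
  -- grows at rate at most `2 * Λ * m + m`, less than the slope of the barrier.
  have key := image_norm_le_of_norm_deriv_right_lt_deriv_boundary (a := s₀) (b := s)
    (f := fun x => u (γ x) - p (γ x)) (B := fun x => m + m * (2 * Λ + 2) * (x - s₀))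
    (B' := fun _ => m * (2 * Λ + 2))
    (fun x _ => (hd x).continuousAt.continuousWithinAt) (fun x _ => (hd x).hasDerivWithinAt)
    (by simpa [hγ] using hb)
    (fun x => by
      simpa using (((hasDerivAt_id x).sub_const s₀).const_mul (m * (2 * Λ + 2))).const_add m)
    (fun x hx hxB => ?_) (Set.right_mem_Icc.2 hs)
  · refine key.trans ?_
    nlinarith
  · have hx2 : ‖u (γ x) - p (γ x)‖ ≤ 2 * m := by
      have h5 : (2 * Λ + 2) * (x - s₀) ≤ (2 * Λ + 2) * (s - s₀) := by
        gcongr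
        exact hx.2.le
      rw [hxB]
      nlinarith
    have h6 := herr (γ x) (by rw [hγre]; exact ht) (by rw [hγre, h2m]; exact hx2)
    rw [hγre] at h6
    have h7 : ‖F (u (γ x)) - (F (p (γ x)) - r (γ x))‖ ≤ Λ * (2 * m) + m := by
      refine (pi_norm_le_iff_of_nonneg (by positivity)).2 fun j => ?_
      have h8 : (F (u (γ x)) - (F (p (γ x)) - r (γ x))) j =
          l j * (u (γ x) - p (γ x)) j +
          (nonlinearPart F (u (γ x)) - nonlinearPart F (p (γ x)) + r (γ x)) j := by
        simp only [Pi.sub_apply, Pi.add_apply, h.apply_eq]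
        ring
      rw [h8]
      refine (norm_add_le _ _).trans (add_le_add ?_ ((norm_le_pi_norm _ j).trans h6))
      rw [norm_mul, Complex.norm_real, Real.norm_eq_abs]
      exact mul_le_mul (hΛ j) ((norm_le_pi_norm _ j).trans hx2) (norm_nonneg _) hΛ0
    rw [norm_smul, norm_mul, Complex.norm_real, Complex.norm_I, Real.norm_eq_abs, hσ]
    nlinarith

end Bootstrap

/-- On a right half-plane, the orbit is an exponential sum up to any exponential order. -/
theorem exists_halfPlane_approximation (h : IsDiagonalOrbit l F u) (K : ℝ) :
    ∃ p : ℂ → Fin N → ℂ, (∀ i, (fun z => p z i) ∈ expSpan (stableExponents l 1)) ∧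
      ∃ M T : ℝ, ∀ z : ℂ, T ≤ z.re → ‖u z - p z‖ ≤ M * Real.exp (-K * z.re) := by
  obtain ⟨Λ, hΛ0, hΛ⟩ : ∃ Λ : ℝ, 0 ≤ Λ ∧ ∀ j, |l j| ≤ Λ :=
    ⟨‖l‖, norm_nonneg _, fun j => norm_le_pi_norm l j⟩
  set K' := max K (Λ + 1) with hK'
  obtain ⟨p, r, hpS, hp, hr, hup⟩ := h.exists_approximate_solution K'
  obtain ⟨c, hc, hS, -⟩ := h.exists_rate
  have hK'0 : 0 < K' := lt_of_lt_of_le (by linarith) (le_max_right _ _)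
  have hp0 : Tendsto p atRight (𝓝 0) :=
    tendsto_pi_nhds.2 fun i => tendsto_zero_atRight_of_mem_expSpan hc hS (hpS i)
  obtain ⟨C₁, hC₁, hr⟩ := hr.exists_pos
  obtain ⟨C₂, hC₂, hup⟩ := hup.exists_pos
  obtain ⟨T₁, hT₁⟩ := eventually_atRight.1 hr.bound
  obtain ⟨T₂, hT₂⟩ := eventually_atTop.1 hup.bound
  simp only [Real.norm_eq_abs, Real.abs_exp] at hT₁ hT₂
  set C := max C₁ C₂ with hCdef
  have hC : 0 < C := hC₁.trans_le (le_max_left _ _)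
  obtain ⟨A, hA, δ, hδ, hq⟩ := h.exists_quadratic_bound
  -- The nonlinearity then has Lipschitz constant at most `1 / 4`, so an error of `4 * C` and a
  -- residual of `C` together give a forcing of at most `2 * C`.
  set δ' := min δ (1 / (4 * A)) with hδ'
  have hδ'0 : 0 < δ' := by positivity
  have hAδ : A * δ' ≤ 1 / 4 := by
    calc A * δ' ≤ A * (1 / (4 * A)) := by gcongr; exact min_le_right _ _
      _ = 1 / 4 := by field_simp
  obtain ⟨T₃, hT₃⟩ := eventually_atRight.1
    (hp0.norm.eventually_le_const (show ‖(0 : Fin N → ℂ)‖ < δ' / 2 by simpa using hδ'0))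
  have h4 : Tendsto (fun t : ℝ => 2 * (2 * C) * Real.exp (-K' * t)) atTop (𝓝 0) := by
    simpa using (tendsto_exp_neg_mul_atTop hK'0).const_mul (2 * (2 * C))
  obtain ⟨T₄, hT₄⟩ := eventually_atTop.1 (h4.eventually_le_const (half_pos hδ'0))
  set T := max (max (max T₁ T₂) (max T₃ T₄)) 0 with hT
  have hTT : T₁ ≤ T ∧ T₂ ≤ T ∧ T₃ ≤ T ∧ T₄ ≤ T ∧ 0 ≤ T := by simp [hT]
  obtain ⟨hTT₁, hTT₂, hTT₃, hTT₄, hTT₀⟩ := hTT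
  have herr : ∀ z : ℂ, T ≤ z.re → ‖u z - p z‖ ≤ 2 * (2 * C) * Real.exp (-K' * z.re) →
      ‖nonlinearPart F (u z) - nonlinearPart F (p z) + r z‖ ≤
        2 * C * Real.exp (-K' * z.re) := by
    intro z hz hb
    have h5 := hT₃ z (hTT₃.trans hz)
    have h6 := hT₄ z.re (hTT₄.trans hz)
    have h7 : ‖u z‖ ≤ δ' := by
      have := norm_le_norm_add_norm_sub' (u z) (p z)
      linarith
    have h8 := hq δ' (min_le_left _ _) (u z) (p z) h7 (by linarith)
    have h9 : ‖r z‖ ≤ C * Real.exp (-K' * z.re) :=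
      (hT₁ z (hTT₁.trans hz)).trans (by gcongr; exact le_max_left _ _)
    calc _ ≤ ‖nonlinearPart F (u z) - nonlinearPart F (p z)‖ + ‖r z‖ := norm_add_le _ _
      _ ≤ 1 / 4 * (2 * (2 * C) * Real.exp (-K' * z.re)) + C * Real.exp (-K' * z.re) := by
          refine add_le_add (h8.trans ?_) h9
          gcongr
      _ = _ := by ring
  set ε : ℝ := 1 / (2 * Λ + 2) with hε
  have hε0 : 0 < ε := by positivity
  have hεΛ : (2 * Λ + 2) * ε = 1 := by rw [hε]; field_simp
  -- Induction on the number of vertical steps of length `ε`, upwards or downwards. The constant `2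
  -- * C` is restored after every step, so it does not depend on the height.
  have key : ∀ σ : ℝ, |σ| = 1 → ∀ n : ℕ, ∀ s : ℝ, 0 ≤ s → s ≤ n * ε → ∀ t : ℝ, T ≤ t →
      ‖u (t + (σ * s : ℝ) * Complex.I) - p (t + (σ * s : ℝ) * Complex.I)‖ ≤
        2 * C * Real.exp (-K' * t) := by
    intro σ hσ n
    induction n with
    | zero =>
      intro s hs hs' t ht
      obtain rfl : s = 0 := le_antisymm (by simpa using hs') hs
      simp only [mul_zero, Complex.ofReal_zero, zero_mul, add_zero]
      refine (hT₂ t (hTT₂.trans ht)).trans ?_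
      gcongr
      linarith [le_max_right C₁ C₂]
    | succ n ih =>
      intro s hs hs' t ht
      rcases le_total s (n * ε) with h5 | h5
      · exact ih s hs h5 t ht
      · refine h.norm_sub_le_on_ray hΛ (le_max_right _ _) hC hp herr (σ * s) (fun x hx => ?_) t ht
        refine h.norm_sub_le_vertical hΛ0 hΛ hC hp herr hσ hx h5 ?_
          (ih (n * ε) (by positivity) le_rfl x hx)
        rw [← hεΛ]
        gcongr
        push_cast at hs'
        linarith
  refine ⟨p, hpS, 2 * C, T, fun z hz => ?_⟩
  have hfin : ‖u z - p z‖ ≤ 2 * C * Real.exp (-K' * z.re) := by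
    obtain ⟨n, hn⟩ := exists_nat_ge (|z.im| / ε)
    rw [div_le_iff₀ hε0] at hn
    rcases le_total 0 z.im with him | him
    · have h5 := key 1 (by simp) n z.im him (by rwa [abs_of_nonneg him] at hn) z.re hz
      rwa [one_mul, Complex.re_add_im] at h5
    · have h5 := key (-1) (by simp) n (-z.im) (by linarith) (by rwa [abs_of_nonpos him] at hn)
        z.re hz
      rwa [neg_one_mul, neg_neg, Complex.re_add_im] at h5
  refine hfin.trans ?_
  have h6 : -K' * z.re ≤ -K * z.re := by nlinarith [le_max_left K (Λ + 1)]
  gcongr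

end IsDiagonalOrbit

/-! ### Recurrence in the strip and boundedness -/

namespace IsDiagonalOrbit

variable {N : ℕ} {l : Fin N → ℝ} {F : (Fin N → ℂ) → (Fin N → ℂ)} {u : ℂ → Fin N → ℂ}

theorem exists_halfPlane_bound (h : IsDiagonalOrbit l F u) :
    ∃ B T : ℝ, ∀ z : ℂ, T ≤ z.re → ‖u z‖ ≤ B := by
  obtain ⟨p, hpS, M, T, hM⟩ := h.exists_halfPlane_approximation 0
  obtain ⟨c, hc, hS, -⟩ := h.exists_rate
  have hp0 : Tendsto p atRight (𝓝 0) :=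
    tendsto_pi_nhds.2 fun i => tendsto_zero_atRight_of_mem_expSpan hc hS (hpS i)
  obtain ⟨T₁, hT₁⟩ := eventually_atRight.1
    (hp0.norm.eventually_le_const (show ‖(0 : Fin N → ℂ)‖ < 1 by simp))
  refine ⟨1 + M, max T T₁, fun z hz => ?_⟩
  have h1 := hM z ((le_max_left _ _).trans hz)
  have h2 := hT₁ z ((le_max_right _ _).trans hz)
  have h3 := norm_le_norm_add_norm_sub' (u z) (p z)
  simp only [neg_zero, zero_mul, Real.exp_zero, mul_one] at h1
  linarith

/-- Continuous dependence backwards in real time, between two time-shifted copies of an orbit. -/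
theorem norm_sub_le_one_of_norm_sub_le (h : IsDiagonalOrbit l F u) {a b B L : ℝ}
    (hB : ∀ t : ℝ, a ≤ t → ‖u t‖ ≤ B) (hL0 : 0 ≤ L)
    (hL : ∀ x y, ‖x‖ ≤ B + 1 → ‖y‖ ≤ B + 1 → ‖F x - F y‖ ≤ L * ‖x - y‖) {w : ℂ}
    (hw : ‖u (b + w) - u b‖ ≤ Real.exp (-(L + 1) * (b - a))) {t : ℝ} (hat : a ≤ t)
    (htb : t ≤ b) : ‖u (t + w) - u t‖ ≤ 1 := by
  have hd : ∀ x : ℝ, HasDerivAt (fun x : ℝ => u ((b - x : ℝ) + w) - u (b - x : ℝ))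
      ((-1 : ℂ) • F (u ((b - x : ℝ) + w)) - (-1 : ℂ) • F (u (b - x : ℝ))) x := by
    intro x
    have h1 : HasDerivAt (fun x : ℝ => ((b - x : ℝ) : ℂ)) (-1) x := by
      simpa using ((hasDerivAt_id x).const_sub b).ofReal_comp
    exact ((h.solution _).scomp x (h1.add_const w)).sub ((h.solution _).scomp x h1)
  -- The barrier stays at most 1, which keeps the shifted orbit in the ball of radius `B + 1` where
  -- `L` is valid. The rate `L + 1` gives the strict inequality on contact.
  have key := image_norm_le_of_norm_deriv_right_lt_deriv_boundary (a := 0) (b := b - t)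
    (f := fun x : ℝ => u ((b - x : ℝ) + w) - u (b - x : ℝ))
    (B := fun x => Real.exp ((L + 1) * (x - (b - a))))
    (B' := fun x => Real.exp ((L + 1) * (x - (b - a))) * (L + 1))
    (fun x _ => (hd x).continuousAt.continuousWithinAt) (fun x _ => (hd x).hasDerivWithinAt)
    ?_ (fun x => ?_) (fun x hx hxB => ?_)
    (Set.right_mem_Icc.2 (by linarith))
  · simp only [sub_sub_cancel] at key
    refine key.trans (Real.exp_le_one_iff.2 ?_)
    nlinarith
  · simp only [sub_zero]
    refine hw.trans_eq ?_
    ring_nf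
  · simpa using ((((hasDerivAt_id x).sub_const (b - a)).const_mul (L + 1))).exp
  · have h1 : Real.exp ((L + 1) * (x - (b - a))) ≤ 1 :=
      Real.exp_le_one_iff.2 (by nlinarith [hx.2])
    have h2 := hB (b - x) (by linarith [hx.2])
    have h3 := norm_le_norm_add_norm_sub' (u ((b - x : ℝ) + w)) (u (b - x : ℝ))
    have h4 := hL (u ((b - x : ℝ) + w)) (u (b - x : ℝ)) (by linarith) (by linarith)
    have h5 : (-1 : ℂ) • F (u ((b - x : ℝ) + w)) - (-1 : ℂ) • F (u (b - x : ℝ)) =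
        -(F (u ((b - x : ℝ) + w)) - F (u (b - x : ℝ))) := by
      simp only [neg_smul, one_smul]
      abel
    rw [h5, norm_neg]
    rw [hxB] at h4
    have h6 := Real.exp_pos ((L + 1) * (x - (b - a)))
    linarith

/-- A real bounded orbit returns close to itself at arbitrarily large imaginary times. -/
theorem eventually_norm_le_recurrenceFilter (h : IsDiagonalOrbit l F u) {a b B : ℝ}
    (hB : ∀ t : ℝ, a ≤ t → ‖u t‖ ≤ B) :
    ∀ᶠ s : ℝ in recurrenceFilter l, ∀ t : ℝ, a ≤ t → t ≤ b →
      ‖u (t + s * Complex.I)‖ ≤ B + 1 ∧ ‖u (t - s * Complex.I)‖ ≤ B + 1 := by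
  obtain ⟨L, hL0, hL⟩ := exists_norm_sub_le_of_differentiable h.entire (B + 1)
  -- The rate `L + 2` beats the loss `L + 1` of backward integration, so at a large `b'` the two
  -- approximation errors use at most half of the allowed distance. Recurrence of `p` takes the
  -- other half.
  obtain ⟨p, hpS, M, T, hM⟩ := h.exists_halfPlane_approximation (L + 2)
  have h1 : Tendsto (fun t : ℝ => 2 * M * Real.exp (-1 * t)) atTop (𝓝 0) := by
    simpa using (tendsto_exp_neg_mul_atTop one_pos).const_mul (2 * M)
  obtain ⟨b', hb', hb'T, hb'b⟩ := ((h1.eventually_lt_const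
    (show 0 < Real.exp ((L + 1) * a) / 2 by positivity)).and
    ((eventually_ge_atTop T).and (eventually_ge_atTop b))).exists
  have h2 : 2 * M * Real.exp (-(L + 2) * b') ≤ Real.exp (-(L + 1) * (b' - a)) / 2 := by
    have h3 : Real.exp (-(L + 2) * b') = Real.exp (-1 * b') * Real.exp (-(L + 1) * b') := by
      rw [← Real.exp_add]; ring_nf
    have h4 : Real.exp (-(L + 1) * (b' - a)) =
        Real.exp ((L + 1) * a) * Real.exp (-(L + 1) * b') := by
      rw [← Real.exp_add]; ring_nf
    rw [h3, h4, ← mul_assoc, mul_div_right_comm]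
    gcongr
  have hclose : ∀ w : ℂ, w.re = 0 →
      ‖p (b' + w) - p b'‖ < Real.exp (-(L + 1) * (b' - a)) / 2 →
      ‖u (b' + w) - u b'‖ ≤ Real.exp (-(L + 1) * (b' - a)) := by
    intro w hw hpw
    have h3 := hM (b' + w) (by simpa [hw] using hb'T)
    have h4 := hM b' (by simpa using hb'T)
    simp only [Complex.add_re, Complex.ofReal_re, hw, add_zero] at h3 h4
    have h5 : u (b' + w) - u b' =
        (u (b' + w) - p (b' + w)) + (p (b' + w) - p b') - (u b' - p b') := by abel
    rw [h5]
    have h6 := norm_sub_le ((u (b' + w) - p (b' + w)) + (p (b' + w) - p b')) (u b' - p b')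
    have h7 := norm_add_le (u (b' + w) - p (b' + w)) (p (b' + w) - p b')
    linarith
  have hfin : ∀ w : ℂ, ‖u (b' + w) - u b'‖ ≤ Real.exp (-(L + 1) * (b' - a)) →
      ∀ t : ℝ, a ≤ t → t ≤ b → ‖u (t + w)‖ ≤ B + 1 := by
    intro w hw t hat htb
    have h3 := h.norm_sub_le_one_of_norm_sub_le hB hL0.le hL hw hat (htb.trans hb'b)
    have h4 := norm_le_norm_add_norm_sub' (u (t + w)) (u t)
    linarith [hB t hat]
  have hrec : Tendsto (fun s : ℝ => p (b' + s * Complex.I)) (recurrenceFilter l) (𝓝 (p b')) ∧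
      Tendsto (fun s : ℝ => p (b' - s * Complex.I)) (recurrenceFilter l) (𝓝 (p b')) :=
    ⟨tendsto_pi_nhds.2 fun i => (tendsto_expSpan_recurrenceFilter l (hpS i) b').1,
      tendsto_pi_nhds.2 fun i => (tendsto_expSpan_recurrenceFilter l (hpS i) b').2⟩
  have hε : 0 < Real.exp (-(L + 1) * (b' - a)) / 2 := by positivity
  filter_upwards [Metric.tendsto_nhds.1 hrec.1 _ hε, Metric.tendsto_nhds.1 hrec.2 _ hε]
    with s hs1 hs2 t hat htb
  rw [dist_eq_norm] at hs1 hs2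
  refine ⟨hfin (s * Complex.I) (hclose _ (by simp) hs1) t hat htb, ?_⟩
  rw [sub_eq_add_neg (b' : ℂ)] at hs2
  rw [sub_eq_add_neg (t : ℂ)]
  exact hfin (-(s * Complex.I)) (hclose _ (by simp) hs2) t hat htb

/-- A complex entire orbit which is homoclinic in real time is constant. -/
theorem apply_eq_apply (h : IsDiagonalOrbit l F u)
    (h' : IsDiagonalOrbit (fun j => -l j) (fun x => -F x) (fun z => u (-z))) (z w : ℂ) :
    u z = u w := by
  have hdu : Differentiable ℂ u := fun z => (h.solution z).differentiableAt
  obtain ⟨B₁, T₁, hB₁⟩ := h.exists_halfPlane_bound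
  obtain ⟨B₂, T₂, hB₂⟩ := h'.exists_halfPlane_bound
  have hB₂' : ∀ z : ℂ, z.re ≤ -T₂ → ‖u z‖ ≤ B₂ := fun z hz => by
    simpa using hB₂ (-z) (by simpa using le_neg.1 hz)
  set a : ℝ := min (-T₂) (T₁ - 1) with ha
  obtain ⟨B₃, hB₃⟩ := (isCompact_Icc (a := a) (b := T₁)).exists_bound_of_continuousOn
    (f := fun t : ℝ => u t) (hdu.continuous.comp Complex.continuous_ofReal).continuousOn
  have hab : a < T₁ := (min_le_right _ _).trans_lt (by linarith)
  have hB : ∀ t : ℝ, a ≤ t → ‖u t‖ ≤ max B₁ B₃ := by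
    intro t ht
    rcases le_total t T₁ with h1 | h1
    · exact (hB₃ t ⟨ht, h1⟩).trans (le_max_right _ _)
    · exact (hB₁ t (by simpa using h1)).trans (le_max_left _ _)
  have hrec := h.eventually_norm_le_recurrenceFilter (b := T₁) hB
  set B := max (max B₁ B₂) (max B₁ B₃ + 1) with hBdef
  have hbound : ∀ z, ‖u z‖ ≤ B := by
    intro z
    rcases le_or_gt T₁ z.re with h1 | h1
    · exact (hB₁ z h1).trans ((le_max_left _ _).trans (le_max_left _ _))
    rcases le_or_gt z.re a with h2 | h2
    · exact (hB₂' z (h2.trans (min_le_left _ _))).trans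
        ((le_max_right _ _).trans (le_max_left _ _))
    obtain ⟨s, hs, hsz⟩ := (hrec.and ((tendsto_recurrenceFilter_atTop l).eventually
      (eventually_gt_atTop |z.im|))).exists
    have hs0 : 0 < s := (abs_nonneg _).trans_lt hsz
    -- The vertical sides lie in the half-planes where `u` is already bounded, the horizontal sides
    -- at recurrent heights; `s` is beyond `|z.im|`, so `z` is inside.
    refine Complex.norm_le_of_forall_mem_frontier_norm_le
      (U := Set.Ioo a T₁ ×ℂ Set.Ioo (-s) s)
      ((Metric.isBounded_Ioo _ _).reProdIm (Metric.isBounded_Ioo _ _)) hdu.diffContOnCl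
      (fun x hx => ?_) (subset_closure ⟨⟨h2, h1⟩, abs_lt.1 hsz⟩)
    rw [Complex.frontier_reProdIm, closure_Ioo hab.ne, closure_Ioo (by linarith),
      frontier_Ioo hab, frontier_Ioo (by linarith)] at hx
    rcases hx with ⟨hx1, hx2⟩ | ⟨hx1, -⟩
    · refine le_trans ?_ (le_max_right _ _)
      have h3 := hs x.re hx1.1 hx1.2
      rcases hx2 with h4 | h4
      · have h5 : x = x.re - s * Complex.I := by
          apply Complex.ext <;> simp [show x.im = -s from h4]
        rw [h5]
        simpa using h3.2
      · have h5 : x = x.re + s * Complex.I := by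
          apply Complex.ext <;> simp [show x.im = s from h4]
        rw [h5]
        simpa using h3.1
    · refine le_trans ?_ (le_max_left _ _)
      rcases hx1 with h4 | h4
      · refine (hB₂' x ?_).trans (le_max_right _ _)
        rw [show x.re = a from h4]
        exact min_le_left _ _
      · exact (hB₁ x (show T₁ ≤ x.re from (show x.re = T₁ from h4).ge)).trans (le_max_left _ _)
  refine hdu.apply_eq_apply_of_bounded ?_ z w
  exact (Metric.isBounded_closedBall (x := (0 : Fin N → ℂ)) (r := B)).subset
    (Set.range_subset_iff.2 fun z => by simpa using hbound z)

end IsDiagonalOrbit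

/-! ### Eigenbasis and nonresonance in coordinates -/

section Spectral

variable {V : Type*} [AddCommGroup V] [Module ℂ V]

theorem spectralSubspace_le_span_eigenvectors {A : Module.End ℂ V} {S : Set ℂ}
    (hdiag : IsDiagonalizable (spectralBlock A S)) (hreal : HasRealSpectrum (spectralBlock A S)) :
    spectralSubspace A S ≤ Submodule.span ℂ {x | ∃ r : ℝ, A x = (r : ℂ) • x} := by
  obtain ⟨b, μ, hb⟩ := hdiag
  intro x hx
  have h1 : (⟨x, hx⟩ : spectralSubspace A S) ∈ Submodule.span ℂ (Set.range b) := by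
    rw [b.span_eq]; trivial
  have h2 := Submodule.mem_map_of_mem (f := (spectralSubspace A S).subtype) h1
  rw [Submodule.map_span] at h2
  refine Submodule.span_mono ?_ h2
  rintro _ ⟨_, ⟨j, rfl⟩, rfl⟩
  have him : (μ j).im = 0 := hreal _ (Module.End.hasEigenvalue_of_hasEigenvector
    (Module.End.hasEigenvector_iff.2 ⟨Module.End.mem_eigenspace_iff.2 (hb j), b.ne_zero j⟩))
  refine ⟨(μ j).re, ?_⟩
  have h3 : ((μ j).re : ℂ) = μ j := Complex.ext rfl him.symm
  rw [h3]
  exact congrArg Subtype.val (hb j)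

variable [FiniteDimensional ℂ V]

/-- The generalized eigenspaces span, and by hyperbolicity each nonzero one lies in the stable or
unstable block. So eigenvectors with real eigenvalues span, and a basis is selected among them. -/
theorem exists_real_eigenbasis {A : Module.End ℂ V}
    (hhyp : ∀ μ : ℂ, A.HasEigenvalue μ → μ.re ≠ 0)
    (hdiag_s : IsDiagonalizable (stableBlock A)) (hdiag_u : IsDiagonalizable (unstableBlock A))
    (hreal_s : HasRealSpectrum (stableBlock A)) (hreal_u : HasRealSpectrum (unstableBlock A))
    {N : ℕ} (hN : Module.finrank ℂ V = N) :
    ∃ (b : Module.Basis (Fin N) ℂ V) (l : Fin N → ℝ), ∀ j, A (b j) = (l j : ℂ) • b j := by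
  have htop : ⊤ ≤ Submodule.span ℂ {x | ∃ r : ℝ, A x = (r : ℂ) • x} := by
    rw [← Module.End.iSup_maxGenEigenspace_eq_top A]
    refine iSup_le fun μ => ?_
    rcases lt_trichotomy μ.re 0 with h | h | h
    · exact (le_iSup₂_of_le (f := fun μ (_ : μ ∈ {μ : ℂ | μ.re < 0}) => A.maxGenEigenspace μ)
        μ h le_rfl).trans (spectralSubspace_le_span_eigenvectors hdiag_s hreal_s)
    · have h1 : A.maxGenEigenspace μ = ⊥ := by
        by_contra h2
        have h3 : A.HasUnifEigenvalue μ ⊤ := h2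
        exact hhyp μ ((Module.End.hasUnifEigenvalue_iff_hasUnifEigenvalue_one (by simp)).1 h3) h
      rw [h1]
      exact bot_le
    · exact (le_iSup₂_of_le (f := fun μ (_ : μ ∈ {μ : ℂ | 0 < μ.re}) => A.maxGenEigenspace μ)
        μ h le_rfl).trans (spectralSubspace_le_span_eigenvectors hdiag_u hreal_u)
  obtain ⟨t, ht, hspan, hli⟩ := exists_linearIndependent ℂ {x | ∃ r : ℝ, A x = (r : ℂ) • x}
  set b := Module.Basis.mk hli (by rw [Subtype.range_coe, hspan]; exact htop) with hb
  have := FiniteDimensional.fintypeBasisIndex b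
  set e := Fintype.equivFinOfCardEq ((Module.finrank_eq_card_basis b).symm.trans hN)
  choose l hl using fun x : t => ht x.2
  refine ⟨b.reindex e, fun j => l (e.symm j), fun j => ?_⟩
  rw [Module.Basis.reindex_apply, hb, Module.Basis.mk_apply]
  exact hl _

/-- Nonresonance is stated over distinct eigenvalues, the basis lists them with multiplicity. Adding
up `n` over the indices sharing an eigenvalue preserves both the order and the weighted sum. -/
theorem ne_sum_of_isNonresonant {A : Module.End ℂ V} {S : Set ℂ}
    (hnonres : IsNonresonant (spectralBlock A S)) {N : ℕ} {b : Module.Basis (Fin N) ℂ V}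
    {l : Fin N → ℝ} (hb : ∀ j, A (b j) = (l j : ℂ) • b j) {j₀ : Fin N} (hj₀ : (l j₀ : ℂ) ∈ S)
    {n : Fin N → ℕ} (hn : ∀ j, (l j : ℂ) ∉ S → n j = 0) (hn2 : 2 ≤ ∑ j, n j) :
    l j₀ ≠ ∑ j, n j * l j := by
  classical
  have heig : ∀ j, (l j : ℂ) ∈ S → (spectralBlock A S).HasEigenvalue (l j) := by
    intro j hj
    have h1 : b j ∈ spectralSubspace A S :=
      (le_iSup₂_of_le (f := fun μ (_ : μ ∈ S) => A.maxGenEigenspace μ) (l j : ℂ) hj le_rfl)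
        (Module.End.eigenspace_le_maxGenEigenspace (Module.End.mem_eigenspace_iff.2 (hb j)))
    refine Module.End.hasEigenvalue_of_hasEigenvector (x := ⟨b j, h1⟩)
      (Module.End.hasEigenvector_iff.2 ⟨Module.End.mem_eigenspace_iff.2 ?_, ?_⟩)
    · exact Subtype.ext (hb j)
    · simpa using b.ne_zero j
  have hsum : ∀ {R : Type} [AddCommMonoid R] (g : Fin N → R), (∀ j, (l j : ℂ) ∉ S → g j = 0) →
      ∑ μ : (spectralBlock A S).Eigenvalues, ∑ j, (if (l j : ℂ) = μ then g j else 0) =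
        ∑ j, g j := by
    intro R _ g hg
    rw [Finset.sum_comm]
    refine Finset.sum_congr rfl fun j _ => ?_
    by_cases hj : (l j : ℂ) ∈ S
    · refine (Finset.sum_eq_single (⟨l j, heig j hj⟩ : (spectralBlock A S).Eigenvalues)
        ?_ ?_).trans (if_pos rfl)
      · intro μ _ hμ
        refine if_neg fun h => hμ (Subtype.ext h.symm)
      · exact fun h => (h (Finset.mem_univ (α := (spectralBlock A S).Eigenvalues) _)).elim
    · simp [hg j hj]
  have key := hnonres ⟨l j₀, heig j₀ hj₀⟩ (fun μ => ∑ j, if (l j : ℂ) = μ then n j else 0)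
    (by rwa [hsum n hn])
  intro h
  refine key ?_
  have h2 := hsum (fun j => (n j : ℂ) * l j) (fun j hj => by simp [hn j hj])
  change (l j₀ : ℂ) = _
  rw [h]
  push_cast
  rw [← h2]
  refine Finset.sum_congr rfl fun μ _ => ?_
  rw [Finset.sum_mul]
  refine Finset.sum_congr rfl fun j _ => ?_
  split_ifs with h3
  · rw [h3]
  · simp

end Spectral

/-- Only negative `l j₀` need a hypothesis, since stable exponents of positive order are negative.
-/
theorem notMem_stableExponents_of_ne_sum {N : ℕ} {l : Fin N → ℝ} (hl : ∀ j, l j ≠ 0)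
    (h : ∀ j₀ (n : Fin N → ℕ), l j₀ < 0 → (∀ j, 0 < l j → n j = 0) → 2 ≤ ∑ j, n j →
      l j₀ ≠ ∑ j, n j * l j) (j₀ : Fin N) : l j₀ ∉ stableExponents l 2 := by
  intro hmem
  obtain ⟨a, ha, hla⟩ := exists_pos_le_abs hl
  have h1 := le_of_mem_stableExponents ha hla (stableExponents_anti l one_le_two hmem)
  obtain ⟨n, hn, hn2, hsum⟩ := hmem
  exact h j₀ n (by linarith) hn hn2 hsum

/-! ### Complex time and conclusion -/

/-- A complex entire function that solves an entire equation at real times solves it at all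
complex times. -/
theorem hasDerivAt_of_hasDerivAt_real {E : Type*} [NormedAddCommGroup E] [NormedSpace ℂ E]
    [CompleteSpace E] {f : E → E} (hf : Differentiable ℂ f) {G : ℂ → E} (hG : Differentiable ℂ G)
    (h : ∀ t : ℝ, HasDerivAt (fun s : ℝ => G s) (f (G t)) t) (z : ℂ) :
    HasDerivAt G (f (G z)) z := by
  have hG' : Differentiable ℂ (deriv G) := fun z => ((hG.analyticAt z).deriv).differentiableAt
  have hreal : ∀ t : ℝ, deriv G t = f (G t) := fun t => by
    have h1 := (hG t).hasDerivAt.scomp t (Complex.ofRealCLM.hasDerivAt (x := t))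
    simp only [Complex.ofRealCLM_apply, Complex.ofReal_one, one_smul] at h1
    exact h1.unique (h t)
  have heq : deriv G = fun z => f (G z) := by
    refine AnalyticOnNhd.eq_of_frequently_eq (z₀ := 0) (fun z _ => hG'.analyticAt z)
      (fun z _ => (hf.comp hG).analyticAt z) ?_
    have h1 : Tendsto (fun t : ℝ => (t : ℂ)) (𝓝[≠] 0) (𝓝[≠] 0) := by
      refine tendsto_nhdsWithin_iff.2 ⟨?_, ?_⟩
      · exact (Complex.continuous_ofReal.tendsto' 0 0 (by simp)).mono_left nhdsWithin_le_nhds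
      · filter_upwards [self_mem_nhdsWithin] with t ht
        simpa using ht
    exact h1.frequently (Frequently.of_forall hreal)
  rw [← congrFun heq z]
  exact (hG z).hasDerivAt

theorem realToComplex_injective {N : ℕ} : Function.Injective (realToComplex (N := N)) :=
  fun _ _ h => funext fun i => Complex.ofReal_injective (congrFun h i)

theorem theorem1p1 (N : ℕ) (f : (Fin N → ℂ) → (Fin N → ℂ)) (v : Fin N → ℂ)
    (hf : IsRealEntire f)
    (hv : IsHyperbolicEquilibrium f v)
    (hdiag_s : IsDiagonalizable (stableBlock (linearization f v)))
    (hdiag_u : IsDiagonalizable (unstableBlock (linearization f v)))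
    (hreal_s : HasRealSpectrum (stableBlock (linearization f v)))
    (hreal_u : HasRealSpectrum (unstableBlock (linearization f v)))
    (hnonres_s : IsNonresonant (stableBlock (linearization f v)))
    (hnonres_u : IsNonresonant (unstableBlock (linearization f v))) :
    ∀ Γ : ℝ → Fin N → ℝ, IsRealHomoclinicOrbit f v Γ → ¬ ExtendsToEntire Γ := by
  rintro Γ hΓ ⟨G, hG, hGΓ⟩
  obtain ⟨b, l, hb⟩ := exists_real_eigenbasis hv.hyperbolic hdiag_s hdiag_u hreal_s hreal_u
    (Module.finrank_fin_fun ℂ (n := N))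
  have hl : ∀ j, l j ≠ 0 := by
    intro j hj
    refine hv.hyperbolic (l j) (Module.End.hasEigenvalue_of_hasEigenvector
      (Module.End.hasEigenvector_iff.2 ⟨Module.End.mem_eigenspace_iff.2 (hb j), b.ne_zero j⟩)) ?_
    simpa using hj
  have hl' : ∀ j, -l j ≠ 0 := fun j => neg_ne_zero.2 (hl j)
  have hodeΓ : ∀ t : ℝ, HasDerivAt (fun s : ℝ => G s) (f (G t)) t := by
    intro t
    have h1 : (fun s : ℝ => G s) = fun s : ℝ => realToComplex (Γ s) := funext hGΓ
    rw [h1, hGΓ]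
    exact hΓ.solution t
  have hode := hasDerivAt_of_hasDerivAt_real hf.entire hG hodeΓ
  set e : (Fin N → ℂ) ≃L[ℂ] (Fin N → ℂ) := b.equivFun.toContinuousLinearEquiv with he
  set F : (Fin N → ℂ) → (Fin N → ℂ) := fun x => e (f (v + e.symm x)) with hF
  set u : ℂ → Fin N → ℂ := fun z => e (G z - v) with hu
  have hFd : Differentiable ℂ F :=
    e.differentiable.comp (hf.entire.comp (e.symm.differentiable.const_add v))
  have hF0 : F 0 = 0 := by simp [hF, hv.equilibrium]
  have hF' : ∀ x j, fderiv ℂ F 0 x j = l j * x j := by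
    intro x j
    have h1 : HasFDerivAt f (fderiv ℂ f v) (v + e.symm 0) := by
      simpa using (hf.entire v).hasFDerivAt
    have h2 : HasFDerivAt F ((e : (Fin N → ℂ) →L[ℂ] (Fin N → ℂ)).comp
        ((fderiv ℂ f v).comp (e.symm : (Fin N → ℂ) →L[ℂ] (Fin N → ℂ)))) 0 :=
      e.hasFDerivAt.comp 0 (h1.comp 0 (e.symm.hasFDerivAt.const_add v))
    rw [h2.fderiv]
    have h3 : e.symm x = ∑ i, x i • b i := b.equivFun_symm_apply x
    have h4 : fderiv ℂ f v (e.symm x) = ∑ i, (l i * x i : ℂ) • b i := by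
      rw [h3, map_sum]
      refine Finset.sum_congr rfl fun i _ => ?_
      have h5 : fderiv ℂ f v (b i) = (l i : ℂ) • b i := hb i
      rw [map_smul, h5, smul_smul, mul_comm]
    have h6 : e.symm (fun i => (l i * x i : ℂ)) = ∑ i, (l i * x i : ℂ) • b i :=
      b.equivFun_symm_apply _
    change e (fderiv ℂ f v (e.symm x)) j = _
    rw [h4, ← h6, ContinuousLinearEquiv.apply_symm_apply]
  have husol : ∀ z, HasDerivAt u (F (u z)) z := by
    intro z
    have h1 := e.hasFDerivAt.comp_hasDerivAt z ((hode z).sub_const v)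
    refine h1.congr_deriv ?_
    simp [hF, hu]
  have hulim : ∀ {L : Filter ℝ}, Tendsto (fun t => realToComplex (Γ t)) L (𝓝 v) →
      Tendsto (fun t : ℝ => u t) L (𝓝 0) := by
    intro L hL
    have h1 := (e.continuous.tendsto (v - v)).comp (hL.sub_const v)
    rw [sub_self, map_zero] at h1
    refine h1.congr fun t => ?_
    simp [hu, hGΓ]
  have h1 : IsDiagonalOrbit l F u :=
    { entire := hFd
      zero := hF0
      linear := hF'
      ne_zero := hl
      nonresonant := notMem_stableExponents_of_ne_sum hl fun j₀ n hj₀ hn hn2 =>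
        ne_sum_of_isNonresonant hnonres_s hb (by simpa using hj₀)
          (fun j hj => hn j (lt_of_le_of_ne (by simpa using hj) (hl j).symm)) hn2
      solution := husol
      tendsto_zero := hulim hΓ.tendsto_atTop }
  -- Time reversal: the backward limit becomes a forward one, and nonresonance of the unstable block
  -- supplies the stable condition for `-l`.
  have h2 : IsDiagonalOrbit (fun j => -l j) (fun x => -F x) (fun z => u (-z)) :=
    { entire := hFd.neg
      zero := by simp [hF0]
      linear := fun x j => by
        have h3 : fderiv ℂ (fun x => -F x) 0 = -fderiv ℂ F 0 := fderiv_fun_neg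
        rw [h3]
        simp [hF']
      ne_zero := hl'
      nonresonant := notMem_stableExponents_of_ne_sum hl' fun j₀ n hj₀ hn hn2 h => by
        refine ne_sum_of_isNonresonant hnonres_u hb (j₀ := j₀) (n := n) (by simpa using hj₀)
          (fun j hj => hn j (neg_pos.2 (lt_of_le_of_ne (by simpa using hj) (hl j)))) hn2 ?_
        simp only [mul_neg, Finset.sum_neg_distrib] at h
        exact neg_injective h
      solution := fun z => by
        refine ((husol (-z)).scomp z (hasDerivAt_neg z)).congr_deriv ?_
        simp
      tendsto_zero := by
        have h3 := (hulim hΓ.tendsto_atBot).comp tendsto_neg_atTop_atBot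
        refine h3.congr fun t => ?_
        simp }
  obtain ⟨s, t, hst⟩ := hΓ.nonstationary
  refine hst (realToComplex_injective ?_)
  have h3 := e.injective (h1.apply_eq_apply h2 s t)
  rw [← hGΓ, ← hGΓ]
  exact sub_left_injective h3
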